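/- Let $m \ge 4$ and let $\mathcal{LF}_m = \langle g_0,\dots,g_{m-1} : g_i g_j = g_j g_i \text{ for all } i \ne j \pm 1 \bmod m\rangle$ be the locally free group with $m$ generators and periodic boundary conditions. A signed heap is a finite set $H$ of pieces $(v,w,\sigma)$ with height $v \in \{1,2,\dots\}$, column $w \in \mathbb{Z}/m$ and sign $\sigma = \pm$, at most one piece at each site $(v,w)$, such that (1) every piece of height $v>1$ in column $w$ has a piece of height $v-1$ in one of the columns $w-1,w,w+1$; (2) two pieces in the same column at consecutive heights have the same sign; (3) two pieces in adjacent columns never have the same height. Let $h_j$ be the height of the highest piece in column $j$ ($h_j=0$ if there is none). Dropping a piece of sign $s$ in column $k$ means: if $h_k > \max\{h_{k-1},h_{k+1}\}$ and the highest piece of column $k$ has sign $-s$, that piece is removed (the two annihilate); otherwise the piece $(\max\{h_{k-1},h_k,h_{k+1}\}+1,\,k,\,s)$ is added. The roof $T(H)$ is the set of pieces of $H$ with no piece above them in their own column or in the two adjacent columns. Let $(k_1,s_1),(k_2,s_2),\dots$ be independent and uniform over the $2m$ pairs (column, sign), let $W_0=\emptyset$, and let $W_n$ be obtained from $W_{n-1}$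 by dropping a piece of sign $s_n$ in column $k_n$. Equivalently, $W_n$ is the random walk on $\mathcal{LF}_m$: there is a bijection from $\mathcal{LF}_m$ onto the set of signed heaps that sends $g_{k_1}^{s_1}\cdots g_{k_n}^{s_n}$ to $W_n$ for every $n$ and every sequence of steps. Then the limit $t_m = \lim_{n\to\infty} \frac1m \mathbb{E}(\#T(W_n))$ exists and $$ t_m \le 0.32893 . $$ Consequently the drift $\zeta_m = \lim_{n\to\infty} \frac1n \mathbb{E}(\#W_n)$, where $\#W_n$ is the number of pieces of $W_n$, exists, equals $1-t_m$, and is at least $0.67107$. In particular $t_m$ does not tend to $\frac13$ as $m\to\infty$, contrary to the conjecture of Vershik, Nechaev and Bikbov. -/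

import Mathlib

open Filter Topology MeasureTheory

/-- The locally free group on `m` generators with periodic boundary conditions,
`⟨g_i, i ∈ ℤ/m : g_i g_j = g_j g_i whenever i ≠ j ± 1⟩`. -/
abbrev LocallyFreeGroup (m : ℕ) : Type :=
  PresentedGroup {r : FreeGroup (ZMod m) | ∃ i j : ZMod m,
    i ≠ j + 1 ∧ i ≠ j - 1 ∧
      r = FreeGroup.of i * FreeGroup.of j * (FreeGroup.of i)⁻¹ * (FreeGroup.of j)⁻¹}

/-- A signed piece over the `m` cyclically arranged columns. -/
@[ext]
structure Piece (m : ℕ) where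
  height : ℕ
  col : ZMod m
  sign : ℤˣ
deriving DecidableEq

/-- Two columns are close if they are equal or cyclically adjacent. -/
def CloseCols {m : ℕ} (i j : ZMod m) : Prop := i = j - 1 ∨ i = j ∨ i = j + 1

instance {m : ℕ} (i j : ZMod m) : Decidable (CloseCols i j) := by
  unfold CloseCols; infer_instance

/-- The finite configurations of pieces that are heaps. -/
structure IsHeap {m : ℕ} (H : Finset (Piece m)) : Prop where
  /-- heights start at `1` -/
  one_le_height : ∀ p ∈ H, 1 ≤ p.height
  /-- a site holds at most one piece -/
  site_unique : ∀ p ∈ H, ∀ q ∈ H, p.height = q.height → p.col = q.col → p = q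
  /-- every piece not on the ground is supported from the level below -/
  supported : ∀ p ∈ H, 1 < p.height → ∃ q ∈ H, q.height + 1 = p.height ∧ CloseCols q.col p.col
  /-- a piece directly on top of another one has the same sign -/
  sign_eq : ∀ p ∈ H, ∀ q ∈ H, p.height = q.height + 1 → p.col = q.col → p.sign = q.sign
  /-- adjacent columns have no pieces at the same height -/
  height_ne : ∀ p ∈ H, ∀ q ∈ H, p.col = q.col + 1 → p.height ≠ q.height

/-- The height of the highest piece in column `k`, and `0` if the column is empty. -/
def colHeight {m : ℕ} (H : Finset (Piece m)) (k : ZMod m) : ℕ :=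
  (H.filter fun p => p.col = k).sup Piece.height

/-- Drop a piece of sign `s` in column `k`. If the highest piece of column `k` is higher than both
neighbouring columns and has the opposite sign, then both pieces annihilate. Otherwise the new
piece comes to rest just above the highest piece of the columns `k - 1`, `k`, `k + 1`. -/
def dropPiece {m : ℕ} (H : Finset (Piece m)) (k : ZMod m) (s : ℤˣ) : Finset (Piece m) :=
  if max (colHeight H (k - 1)) (colHeight H (k + 1)) < colHeight H k ∧
      (⟨colHeight H k, k, -s⟩ : Piece m) ∈ H then
    H.erase ⟨colHeight H k, k, -s⟩
  else
    insert ⟨max (max (colHeight H (k - 1)) (colHeight H k)) (colHeight H (k + 1)) + 1, k, s⟩ H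

/-- The roof: the removable pieces, those with no piece above them in their own column or in one
of the two adjacent columns. -/
def roof {m : ℕ} (H : Finset (Piece m)) : Finset (Piece m) :=
  H.filter fun p => ∀ q ∈ H, CloseCols q.col p.col → ¬ p.height < q.height

/-- One step of the process: a column and a sign. -/
abbrev Step (m : ℕ) : Type := ZMod m × ℤˣ

/-- The heap `W_n` after the first `n` of the steps `ξ`, from the empty heap. -/
def heapProcess {m : ℕ} (ξ : ℕ → Step m) : ℕ → Finset (Piece m)
  | 0 => ∅
  | n + 1 => dropPiece (heapProcess ξ n) (ξ n).1 (ξ n).2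

/-- The walk on the group after the first `n` of the steps `ξ`, from the identity: a step `(k, ±)`
multiplies on the right by `g_k^{±1}`. -/
def groupWalk {m : ℕ} (ξ : ℕ → Step m) : ℕ → LocallyFreeGroup m
  | 0 => 1
  | n + 1 => groupWalk ξ n * (PresentedGroup.of (ξ n).1) ^ ((ξ n).2 : ℤ)

/-- The law of a sequence of independent steps, each uniform over the `2m` possibilities. -/
noncomputable def stepLaw (m : ℕ) [NeZero m] : Measure (ℕ → Step m) :=
  Measure.infinitePi fun _ => (PMF.uniformOfFintype (Step m)).toMeasure

/-- `E(#T(W_n))`, the expected number of pieces in the roof at time `n`. -/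
noncomputable def expectedRoof (m : ℕ) [NeZero m] (n : ℕ) : ℝ :=
  ∫ ξ, ((roof (heapProcess ξ n)).card : ℝ) ∂(stepLaw m)

/-- `E(#W_n)`, the expected number of pieces in the heap at time `n`. -/
noncomputable def expectedSize (m : ℕ) [NeZero m] (n : ℕ) : ℝ :=
  ∫ ξ, ((heapProcess ξ n).card : ℝ) ∂(stepLaw m)

/-! Call a column exposed if it is strictly higher than both neighbours. The roof pieces are the
tops of the exposed columns. In an exposed column one sign adds a piece and the other annihilates;
elsewhere both signs add. Hence the mean growth of the heap in one step is exactly 1 - E(#T)/m, and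
it remains to show that the mean roof converges and to bound its limit.

Existence: in law, the walk after n + 1 steps is a letter times an n-step walk. Left multiplication
by a letter shortens an element exactly when the inverse letter lies on the ground
(`heapLength_letter_mul`), so the growth is an average of ground probabilities. Whether a given
piece of column j is on the ground can change only while the image of the walk in the free group on
g_j, g_{j+1} has norm at most 1 (`norm_project_le_of_ground_ne`), and the mean of 2^(-norm) decays
geometrically (`transition_decay_le`). So the ground probabilities are Cauchy. This uses that heaps
and group elements correspond (`bijOn_toHeap`).

Bound: summed over the 2m steps, the number of exposed columns changes by 2m - 7 #T + R, where R
counts the columns exposed next to or at each roof piece once that piece alone is removed. The value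
1/3 would mean R = #T on average. To control R, the potential also weighs the stacked and covering
columns and the pairs of fresh columns at distance two. The change of the potential is a sum of
contributions of single columns (`IsHeap.sum_potential`), each bounded by a finite check
(`siteDrift_le`) up to a discharging term whose total is at most 2m (`sum_share_le`). For m ≥ 5 this
gives 2008 #T + ΔF ≤ 660 m, with ΔF the summed change of the potential. As the potential is
nonnegative, telescoping and Cesàro means yield t ≤ 660/2008 < 0.32893. The case m = 4 runs the same
way with other constants. -/

/-! ### Distinctness of nearby columns on a cycle of length at least 4. -/

section ColumnArithmetic

variable {m : ℕ}

theorem natCast_zmod_ne_zero {n : ℕ} (h0 : 0 < n) (h : n < m) : (n : ZMod m) ≠ 0 := by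
  rw [Ne, ZMod.natCast_eq_zero_iff]
  exact fun hd => absurd (Nat.le_of_dvd h0 hd) (by omega)

variable [hm : Fact (4 ≤ m)]

theorem zmod_one_ne_zero : (1 : ZMod m) ≠ 0 := by
  have := hm.out
  exact_mod_cast natCast_zmod_ne_zero (m := m) (n := 1) (by omega) (by omega)

theorem zmod_two_ne_zero : (2 : ZMod m) ≠ 0 := by
  have := hm.out
  exact_mod_cast natCast_zmod_ne_zero (m := m) (n := 2) (by omega) (by omega)

theorem zmod_three_ne_zero : (3 : ZMod m) ≠ 0 := by
  have := hm.out
  exact_mod_cast natCast_zmod_ne_zero (m := m) (n := 3) (by omega) (by omega)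

theorem col_succ_ne (k : ZMod m) : k + 1 ≠ k := by simpa using zmod_one_ne_zero

theorem col_pred_ne (k : ZMod m) : k - 1 ≠ k := by simpa using zmod_one_ne_zero

end ColumnArithmetic

/-! ### Heaps under additions and removals; inverses, commutation, roof. -/

section HeapBasics

variable {m : ℕ} {H : Finset (Piece m)} {j k : ZMod m} {s t : ℤˣ}

theorem CloseCols.symm (h : CloseCols j k) : CloseCols k j := by
  rcases h with h | h | h
  · right; right; rw [h]; ring
  · right; left; exact h.symm
  · left; rw [h]; ring

/-- Column `k` is strictly higher than both neighbouring columns. -/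
def Exposed (H : Finset (Piece m)) (k : ZMod m) : Prop :=
  max (colHeight H (k - 1)) (colHeight H (k + 1)) < colHeight H k

instance : Decidable (Exposed H k) := by unfold Exposed; infer_instance

/-- The height at which a new piece in column `k` comes to rest. -/
def restHeight (H : Finset (Piece m)) (k : ZMod m) : ℕ :=
  max (max (colHeight H (k - 1)) (colHeight H k)) (colHeight H (k + 1)) + 1

/-- Add a piece in column `k` without annihilation. -/
def push (H : Finset (Piece m)) (k : ZMod m) (s : ℤˣ) : Finset (Piece m) :=
  insert ⟨restHeight H k, k, s⟩ H

/-- Remove the highest piece of column `k`. -/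
def pop (H : Finset (Piece m)) (k : ZMod m) : Finset (Piece m) :=
  H.filter fun p => ¬(p.col = k ∧ p.height = colHeight H k)

/-- A piece of sign `s` dropped in column `k` annihilates. -/
def Cancels (H : Finset (Piece m)) (k : ZMod m) (s : ℤˣ) : Prop :=
  Exposed H k ∧ (⟨colHeight H k, k, -s⟩ : Piece m) ∈ H

instance : Decidable (Cancels H k s) := by unfold Cancels; infer_instance

theorem height_le_colHeight {p : Piece m} (hp : p ∈ H) : p.height ≤ colHeight H p.col :=
  Finset.le_sup (f := Piece.height) (by simp [hp])

theorem height_le_colHeight_of_col {p : Piece m} (hp : p ∈ H) (hc : p.col = k) :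
    p.height ≤ colHeight H k := hc ▸ height_le_colHeight hp

theorem exists_top (h : 0 < colHeight H k) : ∃ s, (⟨colHeight H k, k, s⟩ : Piece m) ∈ H := by
  have hne : (H.filter fun p => p.col = k).Nonempty := by
    rw [Finset.nonempty_iff_ne_empty]
    intro h0
    simp [colHeight, h0] at h
  obtain ⟨p, hp, he⟩ := Finset.exists_mem_eq_sup _ hne Piece.height
  rw [Finset.mem_filter] at hp
  refine ⟨p.sign, ?_⟩
  have : (⟨colHeight H k, k, p.sign⟩ : Piece m) = p := by
    ext1
    · exact he
    · exact hp.2.symm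
    · rfl
  rw [this]; exact hp.1

theorem colHeight_insert (p : Piece m) :
    colHeight (insert p H) k = if p.col = k then max p.height (colHeight H k)
      else colHeight H k := by
  unfold colHeight
  rw [Finset.filter_insert]
  split_ifs with h
  · rw [Finset.sup_insert]
  · rfl

theorem colHeight_push_self : colHeight (push H k s) k = restHeight H k := by
  unfold push
  rw [colHeight_insert, if_pos rfl]
  simp only [restHeight]; omega

theorem colHeight_push_of_ne (h : j ≠ k) : colHeight (push H k s) j = colHeight H j := by
  unfold push
  rw [colHeight_insert, if_neg (Ne.symm h)]

theorem colHeight_pop_of_ne (h : j ≠ k) : colHeight (pop H k) j = colHeight H j := by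
  unfold colHeight pop
  congr 1
  ext p
  simp only [Finset.mem_filter]
  constructor
  · rintro ⟨⟨h1, -⟩, h3⟩; exact ⟨h1, h3⟩
  · rintro ⟨h1, h3⟩; exact ⟨⟨h1, fun h4 => h (h3 ▸ h4.1)⟩, h3⟩

theorem pop_subset : pop H k ⊆ H := Finset.filter_subset _ _

theorem colHeight_mono {G : Finset (Piece m)} (h : G ⊆ H) : colHeight G k ≤ colHeight H k :=
  Finset.sup_mono (Finset.filter_subset_filter _ h)

theorem colHeight_pop_self_lt (h : 0 < colHeight H k) :
    colHeight (pop H k) k < colHeight H k := by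
  by_contra hc
  have he : colHeight (pop H k) k = colHeight H k :=
    le_antisymm (colHeight_mono pop_subset) (not_lt.1 hc)
  obtain ⟨s, hs⟩ := exists_top (H := pop H k) (k := k) (by omega)
  rw [pop, Finset.mem_filter] at hs
  exact hs.2 ⟨rfl, he⟩

theorem ne_of_not_close (h : ¬ CloseCols j k) : j ≠ k - 1 ∧ j ≠ k ∧ j ≠ k + 1 := by
  unfold CloseCols at h; tauto

theorem ne_of_not_close' (h : ¬ CloseCols j k) : j - 1 ≠ k ∧ j ≠ k ∧ j + 1 ≠ k := by
  obtain ⟨h1, h2, h3⟩ := ne_of_not_close h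
  refine ⟨fun h => h3 ?_, h2, fun h => h1 ?_⟩ <;> rw [← h] <;> ring

theorem exposed_push_far (h : ¬ CloseCols j k) : Exposed (push H k s) j ↔ Exposed H j := by
  obtain ⟨h1, h2, h3⟩ := ne_of_not_close' h
  simp only [Exposed, colHeight_push_of_ne h1, colHeight_push_of_ne h2, colHeight_push_of_ne h3]

theorem exposed_pop_far (h : ¬ CloseCols j k) : Exposed (pop H k) j ↔ Exposed H j := by
  obtain ⟨h1, h2, h3⟩ := ne_of_not_close' h
  simp only [Exposed, colHeight_pop_of_ne h1, colHeight_pop_of_ne h2, colHeight_pop_of_ne h3]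

theorem restHeight_push_far (h : ¬ CloseCols j k) :
    restHeight (push H k s) j = restHeight H j := by
  obtain ⟨h1, h2, h3⟩ := ne_of_not_close' h
  simp only [restHeight, colHeight_push_of_ne h1, colHeight_push_of_ne h2,
    colHeight_push_of_ne h3]

theorem restHeight_pop_far (h : ¬ CloseCols j k) :
    restHeight (pop H k) j = restHeight H j := by
  obtain ⟨h1, h2, h3⟩ := ne_of_not_close' h
  simp only [restHeight, colHeight_pop_of_ne h1, colHeight_pop_of_ne h2,
    colHeight_pop_of_ne h3]

theorem exposed_push_self [Fact (4 ≤ m)] : Exposed (push H k s) k := by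
  simp only [Exposed, colHeight_push_self, colHeight_push_of_ne (col_pred_ne k),
    colHeight_push_of_ne (col_succ_ne k),
    restHeight]
  omega

theorem not_exposed_push_succ [Fact (4 ≤ m)] : ¬ Exposed (push H k s) (k + 1) := by
  simp only [Exposed, add_sub_cancel_right, colHeight_push_self,
    colHeight_push_of_ne (col_succ_ne k),
    restHeight]
  omega

theorem not_exposed_push_pred [Fact (4 ≤ m)] : ¬ Exposed (push H k s) (k - 1) := by
  simp only [Exposed, sub_add_cancel, colHeight_push_self,
    colHeight_push_of_ne (col_pred_ne k),
    restHeight]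
  omega

theorem pop_push_self : pop (push H k s) k = H := by
  ext p
  rw [pop, Finset.mem_filter, colHeight_push_self, push, Finset.mem_insert]
  constructor
  · rintro ⟨rfl | h, h'⟩
    · exact absurd ⟨rfl, rfl⟩ h'
    · exact h
  · intro h
    refine ⟨Or.inr h, fun ⟨h1, h2⟩ => ?_⟩
    have := height_le_colHeight_of_col h h1
    simp only [restHeight] at h2; omega

theorem pop_push_far (h : ¬ CloseCols j k) :
    pop (push H k s) j = push (pop H j) k s := by
  have hk : ¬ CloseCols k j := fun h' => h h'.symm
  have hne := (ne_of_not_close h).2.1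
  have : push (pop H j) k s = insert ⟨restHeight H k, k, s⟩ (pop H j) := by
    unfold push; rw [restHeight_pop_far hk]
  rw [this]
  unfold pop
  rw [colHeight_push_of_ne hne, push, Finset.filter_insert, if_pos]
  exact fun h' => hne h'.1.symm

theorem pop_pop_comm (h : j ≠ k) : pop (pop H j) k = pop (pop H k) j := by
  have h1 : colHeight (pop H j) k = colHeight H k := colHeight_pop_of_ne h.symm
  have h2 : colHeight (pop H k) j = colHeight H j := colHeight_pop_of_ne h
  unfold pop at *
  rw [h1, h2, Finset.filter_comm]

theorem not_exposed_succ (h : Exposed H k) : ¬ Exposed H (k + 1) := by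
  simp only [Exposed, add_sub_cancel_right] at *; omega

theorem Exposed.pos (h : Exposed H k) : 0 < colHeight H k := by
  unfold Exposed at h; omega

theorem not_mem_push : (⟨restHeight H k, k, s⟩ : Piece m) ∉ H := by
  intro h
  have := height_le_colHeight h
  simp only [restHeight] at this; omega

theorem card_push : (push H k s).card = H.card + 1 :=
  Finset.card_insert_of_notMem not_mem_push

theorem IsHeap.pop_eq_erase (hH : IsHeap H) (hm : (⟨colHeight H k, k, t⟩ : Piece m) ∈ H) :
    pop H k = H.erase ⟨colHeight H k, k, t⟩ := by
  ext p
  simp only [pop, Finset.mem_filter, Finset.mem_erase]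
  constructor
  · rintro ⟨h1, h2⟩
    exact ⟨fun h => h2 (by simp [h]), h1⟩
  · rintro ⟨h1, h2⟩
    exact ⟨h2, fun h => h1 (hH.site_unique _ h2 _ hm h.2 h.1)⟩

theorem IsHeap.dropPiece_eq (hH : IsHeap H) (k : ZMod m) (s : ℤˣ) :
    dropPiece H k s = if Cancels H k s then pop H k else push H k s := by
  unfold dropPiece
  by_cases h : Cancels H k s
  · rw [if_pos h, hH.pop_eq_erase h.2]; exact if_pos h
  · rw [if_neg h]; exact if_neg h

theorem dropPiece_of_not_cancels (h : ¬ Cancels H k s) : dropPiece H k s = push H k s :=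
  if_neg h

theorem IsHeap.dropPiece_of_cancels (hH : IsHeap H) (h : Cancels H k s) :
    dropPiece H k s = pop H k := by rw [hH.dropPiece_eq, if_pos h]

theorem isHeap_empty : IsHeap (∅ : Finset (Piece m)) := by
  constructor <;> simp

theorem IsHeap.isHeap_push [Fact (4 ≤ m)] (hH : IsHeap H) (h : ¬ Cancels H k s) :
    IsHeap (push H k s) := by
  have key : ∀ q ∈ H, CloseCols q.col k → q.height < restHeight H k := by
    intro q hq hc
    have h1 := height_le_colHeight hq
    unfold restHeight
    rcases hc with hc | hc | hc <;> rw [hc] at h1 <;> omega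
  constructor
  · intro p hp
    rcases Finset.mem_insert.1 hp with rfl | hp
    · simp [restHeight]
    · exact hH.one_le_height p hp
  · intro p hp q hq hh hc
    rcases Finset.mem_insert.1 hp with rfl | hp <;> rcases Finset.mem_insert.1 hq with rfl | hq
    · rfl
    · exact absurd hh (key q hq (Or.inr (Or.inl hc.symm))).ne'
    · exact absurd hh (key p hp (Or.inr (Or.inl hc))).ne
    · exact hH.site_unique p hp q hq hh hc
  · intro p hp h1
    rcases Finset.mem_insert.1 hp with rfl | hp
    · have : ∃ i, CloseCols i k ∧ colHeight H i + 1 = restHeight H k := by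
        rcases le_total (max (colHeight H (k - 1)) (colHeight H k)) (colHeight H (k + 1))
          with h2 | h2
        · exact ⟨k + 1, Or.inr (Or.inr rfl), by unfold restHeight; omega⟩
        · rcases le_total (colHeight H (k - 1)) (colHeight H k) with h3 | h3
          · exact ⟨k, Or.inr (Or.inl rfl), by unfold restHeight; omega⟩
          · exact ⟨k - 1, Or.inl rfl, by unfold restHeight; omega⟩
      obtain ⟨i, hi, he⟩ := this
      obtain ⟨r, hr⟩ := exists_top (H := H) (k := i) (by simp only at h1; omega)
      exact ⟨_, Finset.mem_insert_of_mem hr, he, hi⟩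
    · obtain ⟨q, hq, h2⟩ := hH.supported p hp h1
      exact ⟨q, Finset.mem_insert_of_mem hq, h2⟩
  · intro p hp q hq hh hc
    rcases Finset.mem_insert.1 hp with rfl | hp <;> rcases Finset.mem_insert.1 hq with rfl | hq
    · rfl
    -- If the piece below had the opposite sign, the drop would have annihilated. The rest height
    -- gives only that the neighbours are no higher than column `k`; `height_ne` makes this strict,
    -- so the column is exposed.
    · by_contra hs
      apply h
      simp only at hh hc hs
      have h1 := height_le_colHeight hq
      rw [← hc] at h1
      have hk : colHeight H k = q.height := by unfold restHeight at hh; omega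
      have hq' : q = ⟨colHeight H k, k, -s⟩ := by
        ext1
        · exact hk.symm
        · exact hc.symm
        · rcases Int.units_eq_one_or s with h | h <;>
            rcases Int.units_eq_one_or q.sign with h' | h' <;> simp_all
      have h0 := hH.one_le_height q hq
      refine ⟨?_, hq' ▸ hq⟩
      have ha : colHeight H (k - 1) ≠ colHeight H k := by
        intro he
        obtain ⟨r, hr⟩ := exists_top (H := H) (k := k - 1) (by omega)
        exact hH.height_ne q hq _ hr (by simp [← hc]) (by simp [he, hk])
      have hb : colHeight H (k + 1) ≠ colHeight H k := by
        intro he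
        obtain ⟨r, hr⟩ := exists_top (H := H) (k := k + 1) (by omega)
        exact hH.height_ne _ hr q hq (by simp [← hc]) (by simp [he, hk])
      unfold Exposed; unfold restHeight at hh; omega
    · have := key p hp (Or.inr (Or.inl hc))
      simp only at hh; omega
    · exact hH.sign_eq p hp q hq hh hc
  · intro p hp q hq hc
    rcases Finset.mem_insert.1 hp with rfl | hp <;> rcases Finset.mem_insert.1 hq with rfl | hq
    · exact absurd hc.symm (col_succ_ne _)
    · exact (key q hq (Or.inl (by simp only at hc; rw [hc]; ring))).ne'
    · exact (key p hp (Or.inr (Or.inr hc))).ne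
    · exact hH.height_ne p hp q hq hc


theorem Exposed.height_lt (h : Exposed H k) {q : Piece m} (hq : q ∈ H)
    (hc : CloseCols q.col k) (hne : q.col ≠ k) : q.height < colHeight H k := by
  have h1 := height_le_colHeight hq
  unfold Exposed at h
  rcases hc with hc | hc | hc
  · rw [hc] at h1; omega
  · exact absurd hc hne
  · rw [hc] at h1; omega

theorem Exposed.height_le (h : Exposed H k) {q : Piece m} (hq : q ∈ H)
    (hc : CloseCols q.col k) : q.height ≤ colHeight H k := by
  by_cases hne : q.col = k
  · exact height_le_colHeight_of_col hq hne
  · exact (h.height_lt hq hc hne).le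

/-- Nothing rests on the top of an exposed column, so its removal leaves every other piece
supported. -/
theorem IsHeap.isHeap_pop (hH : IsHeap H) (h : Exposed H k) : IsHeap (pop H k) := by
  have sub : ∀ p ∈ pop H k, p ∈ H := fun p hp => pop_subset hp
  constructor
  · exact fun p hp => hH.one_le_height p (sub p hp)
  · exact fun p hp q hq => hH.site_unique p (sub p hp) q (sub q hq)
  · intro p hp h1
    obtain ⟨q, hq, h2, h3⟩ := hH.supported p (sub p hp) h1
    refine ⟨q, Finset.mem_filter.2 ⟨hq, fun ⟨h4, h5⟩ => ?_⟩, h2, h3⟩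
    have := h.height_le (sub p hp) (h4 ▸ h3.symm)
    omega
  · exact fun p hp q hq => hH.sign_eq p (sub p hp) q (sub q hq)
  · exact fun p hp q hq => hH.height_ne p (sub p hp) q (sub q hq)

theorem IsHeap.drop [Fact (4 ≤ m)] (hH : IsHeap H) (k : ZMod m) (s : ℤˣ) :
    IsHeap (dropPiece H k s) := by
  rw [hH.dropPiece_eq]
  split_ifs with h
  · exact hH.isHeap_pop h.1
  · exact hH.isHeap_push h

theorem IsHeap.top_sign (hH : IsHeap H) (hs : (⟨colHeight H k, k, s⟩ : Piece m) ∈ H)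
    (ht : (⟨colHeight H k, k, t⟩ : Piece m) ∈ H) : s = t :=
  congrArg Piece.sign (hH.site_unique _ hs _ ht rfl rfl)

/-- Support of the removed piece from one level below forces a new piece back to the same height. It
cannot annihilate: an exposed top revealed by the removal lay directly beneath, so `sign_eq` gives
it the same sign. -/
theorem IsHeap.push_pop (hH : IsHeap H) (h : Exposed H k)
    (hs : (⟨colHeight H k, k, s⟩ : Piece m) ∈ H) :
    push (pop H k) k s = H ∧ ¬ Cancels (pop H k) k s := by
  have hlt := colHeight_pop_self_lt h.pos
  by_cases h1 : k - 1 = k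
  · exfalso; unfold Exposed at h; rw [h1] at h; omega
  by_cases h2 : k + 1 = k
  · exfalso; unfold Exposed at h; rw [h2] at h; omega
  have e1 : colHeight (pop H k) (k - 1) = colHeight H (k - 1) := colHeight_pop_of_ne h1
  have e2 : colHeight (pop H k) (k + 1) = colHeight H (k + 1) := colHeight_pop_of_ne h2
  have hx := h
  unfold Exposed at hx
  have hrest : restHeight (pop H k) k = colHeight H k := by
    unfold restHeight
    rw [e1, e2]
    rcases Nat.lt_or_ge 1 (colHeight H k) with hv | hv
    · obtain ⟨q, hq, h3, h4⟩ := hH.supported _ hs hv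
      simp only at h3 h4
      have hq' : q ∈ pop H k := Finset.mem_filter.2 ⟨hq, fun h5 => by omega⟩
      have h5 := height_le_colHeight hq'
      rcases h4 with h4 | h4 | h4 <;> rw [h4] at h5
      · rw [e1] at h5; omega
      · omega
      · rw [e2] at h5; omega
    · omega
  refine ⟨?_, ?_⟩
  · rw [push, hrest, hH.pop_eq_erase hs, Finset.insert_erase hs]
  · rintro ⟨h3, h4⟩
    have hv := h3.pos
    unfold Exposed at h3
    rw [e1, e2] at h3
    have h5 : colHeight H k = colHeight (pop H k) k + 1 := by
      unfold restHeight at hrest; rw [e1, e2] at hrest; omega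
    have := hH.sign_eq _ hs _ (pop_subset h4) h5 rfl
    simp only at this
    rcases Int.units_eq_one_or s with h | h <;> simp [h] at this

theorem IsHeap.drop_drop_neg [Fact (4 ≤ m)] (hH : IsHeap H) (k : ZMod m) (s : ℤˣ) :
    dropPiece (dropPiece H k s) k (-s) = H := by
  by_cases h : Cancels H k s
  · have := hH.push_pop h.1 h.2
    rw [hH.dropPiece_of_cancels h, dropPiece_of_not_cancels this.2, this.1]
  · have hc : Cancels (push H k s) k (-s) := by
      refine ⟨exposed_push_self, ?_⟩
      rw [colHeight_push_self, neg_neg]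
      exact Finset.mem_insert_self _ _
    rw [dropPiece_of_not_cancels h, (hH.isHeap_push h).dropPiece_of_cancels hc, pop_push_self]

theorem cancels_push_far (h : ¬ CloseCols j k) :
    Cancels (push H k t) j s ↔ Cancels H j s := by
  unfold Cancels
  rw [exposed_push_far h, colHeight_push_of_ne (ne_of_not_close h).2.1, push, Finset.mem_insert]
  have : (⟨colHeight H j, j, -s⟩ : Piece m) ≠ ⟨restHeight H k, k, t⟩ := fun he =>
    (ne_of_not_close h).2.1 (congrArg Piece.col he)
  simp [this]

theorem cancels_pop_far (h : ¬ CloseCols j k) :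
    Cancels (pop H k) j s ↔ Cancels H j s := by
  unfold Cancels
  rw [exposed_pop_far h, colHeight_pop_of_ne (ne_of_not_close h).2.1]
  have := (ne_of_not_close h).2.1
  simp [pop, this]

theorem push_push_comm (h : ¬ CloseCols j k) :
    push (push H k t) j s = push (push H j s) k t := by
  have hk : ¬ CloseCols k j := fun h' => h h'.symm
  conv_lhs => rw [push, restHeight_push_far h, push, Finset.insert_comm]
  conv_rhs => rw [push, restHeight_push_far hk, push]

theorem IsHeap.drop_comm [Fact (4 ≤ m)] (hH : IsHeap H) (h : ¬ CloseCols j k) (s t : ℤˣ) :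
    dropPiece (dropPiece H k t) j s = dropPiece (dropPiece H j s) k t := by
  have hk : ¬ CloseCols k j := fun h' => h h'.symm
  rw [(hH.drop k t).dropPiece_eq, (hH.drop j s).dropPiece_eq, hH.dropPiece_eq k t,
    hH.dropPiece_eq j s]
  by_cases h1 : Cancels H k t <;> by_cases h2 : Cancels H j s <;>
    simp only [h1, h2, if_true, if_false, cancels_push_far h, cancels_push_far hk,
      cancels_pop_far h, cancels_pop_far hk]
  · exact pop_pop_comm (ne_of_not_close hk).2.1
  · exact (pop_push_far hk).symm
  · exact pop_push_far h
  · exact push_push_comm h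

theorem IsHeap.card_pop (hH : IsHeap H) (h : Exposed H k) :
    (pop H k).card + 1 = H.card := by
  obtain ⟨s, hs⟩ := exists_top h.pos
  rw [hH.pop_eq_erase hs, Finset.card_erase_of_mem hs]
  have := Finset.card_pos.2 ⟨_, hs⟩
  omega

/-- The roof condition allows neighbours of equal height, whereas `Exposed` does not; `height_ne`
excludes equality in a heap. -/
theorem IsHeap.mem_roof_iff (hH : IsHeap H) {p : Piece m} :
    p ∈ roof H ↔ p ∈ H ∧ Exposed H p.col ∧ p.height = colHeight H p.col := by
  rw [roof, Finset.mem_filter]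
  refine and_congr_right fun hp => ⟨fun h => ?_, fun ⟨h1, h2⟩ q hq hc => ?_⟩
  · have key : ∀ i, CloseCols i p.col → colHeight H i ≤ p.height := by
      intro i hi
      by_contra hlt
      obtain ⟨s, hs⟩ := exists_top (H := H) (k := i) (by omega)
      exact h _ hs hi (by simp only; omega)
    have h0 := hH.one_le_height p hp
    have he : p.height = colHeight H p.col :=
      le_antisymm (height_le_colHeight hp) (key _ (Or.inr (Or.inl rfl)))
    refine ⟨?_, he⟩
    have h1 := key _ (Or.inl rfl : CloseCols (p.col - 1) p.col)
    have h2 := key _ (Or.inr (Or.inr rfl) : CloseCols (p.col + 1) p.col)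
    have h3 : colHeight H (p.col - 1) ≠ p.height := by
      intro he
      obtain ⟨s, hs⟩ := exists_top (H := H) (k := p.col - 1) (by omega)
      exact hH.height_ne p hp _ hs (by simp) (by simp [he])
    have h4 : colHeight H (p.col + 1) ≠ p.height := by
      intro he
      obtain ⟨s, hs⟩ := exists_top (H := H) (k := p.col + 1) (by omega)
      exact hH.height_ne _ hs p hp (by simp) (by simp [he])
    unfold Exposed; omega
  · have := h1.height_le hq hc
    omega

theorem IsHeap.card_roof [NeZero m] (hH : IsHeap H) :
    (roof H).card = (Finset.univ.filter fun k => Exposed H k).card := by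
  refine Finset.card_bij (fun p _ => p.col) ?_ ?_ ?_
  · intro p hp
    simpa using (hH.mem_roof_iff.1 hp).2.1
  · intro p hp q hq h
    rw [hH.mem_roof_iff] at hp hq
    exact hH.site_unique p hp.1 q hq.1 (by rw [hp.2.2, hq.2.2, h]) h
  · intro k hk
    simp only [Finset.mem_filter, Finset.mem_univ, true_and] at hk
    obtain ⟨s, hs⟩ := exists_top hk.pos
    exact ⟨_, hH.mem_roof_iff.2 ⟨hs, hk, rfl⟩, rfl⟩

/-- The two signs dropped in column `k`: together they give one addition and one removal if the
column is exposed, and two additions otherwise. -/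
theorem IsHeap.sum_sign [Fact (4 ≤ m)] (hH : IsHeap H) (k : ZMod m) {f : Finset (Piece m) → ℤ}
    {a b : ℤ} (ha : ∀ s, ¬ Cancels H k s → f (push H k s) = a)
    (hb : Exposed H k → f (pop H k) = b) :
    ∑ s : ℤˣ, f (dropPiece H k s) = if Exposed H k then a + b else 2 * a := by
  have huniv : ∀ r : ℤˣ, ∑ s : ℤˣ, f (dropPiece H k s) =
      f (dropPiece H k r) + f (dropPiece H k (-r)) := by
    intro r
    rw [show (Finset.univ : Finset ℤˣ) = {1, -1} from rfl, Finset.sum_pair (by decide)]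
    rcases Int.units_eq_one_or r with h | h
    · rw [h]
    · rw [h, neg_neg, add_comm]
  split_ifs with h
  · obtain ⟨s, hs⟩ := exists_top h.pos
    have h1 : ¬ Cancels H k s := fun hc => by
      have := hH.top_sign hs hc.2
      rcases Int.units_eq_one_or s with h | h <;> simp [h] at this
    have h2 : Cancels H k (-s) := ⟨h, by rwa [neg_neg]⟩
    rw [huniv s, dropPiece_of_not_cancels h1, hH.dropPiece_of_cancels h2, ha s h1, hb h]
  · have hc : ∀ s, ¬ Cancels H k s := fun s hc => h hc.1
    rw [huniv 1, dropPiece_of_not_cancels (hc _), dropPiece_of_not_cancels (hc _), ha _ (hc _),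
      ha _ (hc _), two_mul]

end HeapBasics

/-! ### The action of the group on heaps, and the bijection between them. -/

section GroupAction

variable {m : ℕ} {H : Finset (Piece m)} {j k : ZMod m} {s t : ℤˣ}

/-- The letter `g_k^s`. -/
def letter (k : ZMod m) (s : ℤˣ) : LocallyFreeGroup m := (PresentedGroup.of k) ^ (s : ℤ)

theorem letter_one : letter k 1 = PresentedGroup.of k := by simp [letter]

theorem letter_neg : letter k (-s) = (letter k s)⁻¹ := by simp [letter]

theorem commute_of (h : ¬ CloseCols j k ∨ j = k) :
    Commute (PresentedGroup.of j : LocallyFreeGroup m) (PresentedGroup.of k) := by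
  rcases h with h | rfl
  · obtain ⟨h1, h2, h3⟩ := ne_of_not_close h
    have hr := PresentedGroup.one_of_mem (rels := {r : FreeGroup (ZMod m) | ∃ i j : ZMod m,
      i ≠ j + 1 ∧ i ≠ j - 1 ∧
      r = FreeGroup.of i * FreeGroup.of j * (FreeGroup.of i)⁻¹ * (FreeGroup.of j)⁻¹})
      (x := FreeGroup.of j * FreeGroup.of k * (FreeGroup.of j)⁻¹ * (FreeGroup.of k)⁻¹)
      ⟨j, k, h3, h1, rfl⟩
    simp only [map_mul, map_inv] at hr
    have h4 := mul_inv_eq_one.1 hr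
    exact mul_inv_eq_iff_eq_mul.1 h4
  · exact Commute.refl _

theorem commute_letter (h : ¬ CloseCols j k ∨ j = k) :
    Commute (letter j s) (letter k t) :=
  ((commute_of h).zpow_left _).zpow_right _

theorem letter_induction {p : LocallyFreeGroup m → Prop} (w : LocallyFreeGroup m) (h1 : p 1)
    (h : ∀ w k s, p w → p (w * letter k s)) : p w := by
  have hw : w ∈ Subgroup.closure (Set.range (PresentedGroup.of :
      ZMod m → LocallyFreeGroup m)) := by
    rw [PresentedGroup.closure_range_of]; trivial
  induction hw using Subgroup.closure_induction_right with
  | one => exact h1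
  | mul_right x _ y hy ih =>
    obtain ⟨k, rfl⟩ := hy
    rw [← letter_one]; exact h x k 1 ih
  | mul_inv_cancel x _ y hy ih =>
    obtain ⟨k, rfl⟩ := hy
    rw [← letter_one, ← letter_neg]; exact h x k (-1) ih

theorem IsHeap.exists_exposed (hH : IsHeap H) (hne : H.Nonempty) : ∃ k, Exposed H k := by
  obtain ⟨p, hp, hmax⟩ := H.exists_max_image Piece.height hne
  have h0 := hH.one_le_height p hp
  have key : ∀ i, colHeight H i ≤ p.height := by
    intro i
    by_contra hlt
    obtain ⟨s, hs⟩ := exists_top (H := H) (k := i) (by omega)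
    have := hmax _ hs
    simp only at this; omega
  have hroof : p ∈ roof H := by
    rw [roof, Finset.mem_filter]
    exact ⟨hp, fun q hq _ => not_lt.2 (hmax q hq)⟩
  exact ⟨_, (hH.mem_roof_iff.1 hroof).2.1⟩

theorem empty_of_restHeight_eq_one (hH : IsHeap H) (h : restHeight H j = 1) :
    ∀ p ∈ H, ¬ CloseCols p.col j := by
  intro p hp hc
  have h1 := height_le_colHeight hp
  have h2 := hH.one_le_height p hp
  unfold restHeight at h
  rcases hc with hc | hc | hc <;> rw [hc] at h1 <;> omega

/-- `Reduced H w`: the heap `H` is built without annihilations by a word that represents `w`. -/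
inductive Reduced : Finset (Piece m) → LocallyFreeGroup m → Prop
  | empty : Reduced ∅ 1
  | add {H : Finset (Piece m)} {w : LocallyFreeGroup m} (k : ZMod m) (s : ℤˣ) :
      Reduced H w → ¬ Cancels H k s → Reduced (push H k s) (w * letter k s)

theorem Reduced.commute_letter_of_empty {w : LocallyFreeGroup m} (h : Reduced H w)
    (he : ∀ p ∈ H, ¬ CloseCols p.col j) : Commute w (letter j t) := by
  induction h with
  | empty => exact Commute.one_left _
  | add k s _ _ ih =>
    refine (ih fun p hp => he p (Finset.mem_insert_of_mem hp)).mul_left ?_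
    exact commute_letter (Or.inl (he _ (Finset.mem_insert_self _ _)))

variable [Fact (4 ≤ m)]

variable (m) in
/-- The signed heaps over `m` columns. -/
abbrev HeapSpace : Type := {H : Finset (Piece m) // IsHeap H}

/-- Dropping a positive piece in column `k` permutes the heaps. -/
def dropPerm (k : ZMod m) : Equiv.Perm (HeapSpace m) where
  toFun H := ⟨dropPiece H.1 k 1, H.2.drop k 1⟩
  invFun H := ⟨dropPiece H.1 k (-1), H.2.drop k (-1)⟩
  left_inv H := Subtype.ext (H.2.drop_drop_neg k 1)
  right_inv H := Subtype.ext (by simpa using H.2.drop_drop_neg k (-1))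

variable (m) in
/-- The right action of the locally free group on heaps. -/
def heapAction : LocallyFreeGroup m →* (Equiv.Perm (HeapSpace m))ᵐᵒᵖ :=
  PresentedGroup.toGroup (f := fun k => MulOpposite.op (dropPerm k)) (by
    rintro r ⟨i, j, h1, h2, rfl⟩
    have hc : (dropPerm i) * (dropPerm j) = dropPerm j * dropPerm i := by
      by_cases h : i = j
      · rw [h]
      ext1 H
      exact Subtype.ext (H.2.drop_comm (by unfold CloseCols; tauto) 1 1)
    simp only [map_mul, map_inv, FreeGroup.lift_apply_of]
    rw [mul_inv_eq_one, mul_inv_eq_iff_eq_mul, ← MulOpposite.op_mul, ← MulOpposite.op_mul, hc])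

/-- The heap of a group element. -/
def toHeap (w : LocallyFreeGroup m) : Finset (Piece m) :=
  ((heapAction m w).unop ⟨∅, isHeap_empty⟩).1

theorem isHeap_toHeap (w : LocallyFreeGroup m) : IsHeap (toHeap w) :=
  ((heapAction m w).unop ⟨∅, isHeap_empty⟩).2

theorem toHeap_one : toHeap (1 : LocallyFreeGroup m) = ∅ := by
  simp [toHeap]

theorem heapAction_letter (H : HeapSpace m) :
    ((heapAction m (letter k s)).unop H).1 = dropPiece H.1 k s := by
  rcases Int.units_eq_one_or s with h | h
  · rw [h, letter_one, heapAction, PresentedGroup.toGroup.of]; rfl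
  · rw [h, letter_neg, letter_one, map_inv, heapAction, PresentedGroup.toGroup.of]; rfl

theorem toHeap_mul_letter (w : LocallyFreeGroup m) (k : ZMod m) (s : ℤˣ) :
    toHeap (w * letter k s) = dropPiece (toHeap w) k s := by
  rw [toHeap, map_mul, MulOpposite.unop_mul, Equiv.Perm.mul_apply, heapAction_letter]
  rfl

theorem toHeap_groupWalk (ξ : ℕ → Step m) (n : ℕ) :
    toHeap (groupWalk ξ n) = heapProcess ξ n := by
  induction n with
  | zero => exact toHeap_one
  | succ n ih => rw [groupWalk, heapProcess, ← ih]; exact toHeap_mul_letter _ _ _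

theorem Reduced.isHeap {w : LocallyFreeGroup m} (h : Reduced H w) : IsHeap H := by
  induction h with
  | empty => exact isHeap_empty
  | add k s _ hc ih => exact ih.isHeap_push hc

/-- Induction on the reduced word. A last letter in column `k` is the one cancelled; a last letter
in an adjacent column would hide column `k`; any other last letter commutes with the new one and can
be put back after it. -/
theorem Reduced.pop {w : LocallyFreeGroup m} (h : Reduced H w) :
    ∀ {k : ZMod m} {s : ℤˣ}, Cancels H k s → Reduced (pop H k) (w * letter k s) := by
  induction h with
  | empty => intro k s hc; simpa using hc.2
  | @add H w i r h hn ih =>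
    intro k s hc
    by_cases hk : CloseCols k i
    · have hki : k = i := by
        rcases hk with h' | h' | h'
        · exact absurd hc.1 (h' ▸ not_exposed_push_pred)
        · exact h'
        · exact absurd hc.1 (h' ▸ not_exposed_push_succ)
      subst hki
      have hr : r = -s := by
        refine (h.isHeap.isHeap_push hn).top_sign (k := k) ?_ hc.2
        rw [colHeight_push_self]
        exact Finset.mem_insert_self _ _
      rw [pop_push_self, hr, letter_neg, inv_mul_cancel_right]
      exact h
    · have hc' : Cancels H k s := (cancels_push_far hk).1 hc
      have hk' : ¬ CloseCols i k := fun h' => hk h'.symm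
      rw [pop_push_far hk, mul_assoc, (commute_letter (Or.inl hk')).eq, ← mul_assoc]
      exact (ih hc').add i r (by rwa [cancels_pop_far hk'])

theorem Reduced.drop {w : LocallyFreeGroup m} (h : Reduced H w) (k : ZMod m) (s : ℤˣ) :
    Reduced (dropPiece H k s) (w * letter k s) := by
  rw [h.isHeap.dropPiece_eq]
  split_ifs with hc
  · exact h.pop hc
  · exact h.add k s hc

theorem reduced_toHeap (w : LocallyFreeGroup m) : Reduced (toHeap w) w := by
  induction w using letter_induction with
  | h1 => rw [toHeap_one]; exact .empty
  | h w k s ih => rw [toHeap_mul_letter]; exact ih.drop k s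

/-- The only reduced construction of the empty heap is the empty word, so the empty heap has trivial
stabiliser. -/
theorem toHeap_eq_empty {w : LocallyFreeGroup m} (h : toHeap w = ∅) : w = 1 := by
  have hr := reduced_toHeap w
  rw [h] at hr
  generalize hE : (∅ : Finset (Piece m)) = E at hr
  cases hr with
  | empty => rfl
  | add k s _ _ => exact absurd hE.symm (Finset.insert_ne_empty _ _)

theorem toHeap_injective : Function.Injective (toHeap (m := m)) := by
  intro v w h
  have h1 : toHeap (v * w⁻¹) = toHeap (w * w⁻¹) := by
    unfold toHeap at h ⊢
    rw [map_mul, map_mul, MulOpposite.unop_mul, MulOpposite.unop_mul, Equiv.Perm.mul_apply,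
      Equiv.Perm.mul_apply, Subtype.ext h]
  rw [mul_inv_cancel, toHeap_one] at h1
  exact mul_inv_eq_one.1 (toHeap_eq_empty h1)

theorem exists_toHeap_eq (n : ℕ) : ∀ H : Finset (Piece m), IsHeap H → H.card = n →
    ∃ w, toHeap w = H := by
  induction n with
  | zero => intro H _ h; exact ⟨1, by rw [toHeap_one, Finset.card_eq_zero.1 h]⟩
  | succ n ih =>
    intro H hH hc
    obtain ⟨k, hk⟩ := hH.exists_exposed (Finset.card_pos.1 (by omega))
    obtain ⟨s, hs⟩ := exists_top hk.pos
    have h1 := hH.card_pop hk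
    obtain ⟨w, hw⟩ := ih (_root_.pop H k) (hH.isHeap_pop hk) (by omega)
    obtain ⟨h2, h3⟩ := hH.push_pop hk hs
    exact ⟨w * letter k s, by rw [toHeap_mul_letter, hw, dropPiece_of_not_cancels h3, h2]⟩

theorem bijOn_toHeap : Set.BijOn (toHeap (m := m)) Set.univ {H | IsHeap H} :=
  ⟨fun w _ => isHeap_toHeap w, toHeap_injective.injOn, fun H hH =>
    let ⟨w, hw⟩ := exists_toHeap_eq _ H hH rfl
    ⟨w, trivial, hw⟩⟩

/-- The length of a group element, the number of pieces of its heap. -/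
def heapLength (w : LocallyFreeGroup m) : ℕ := (toHeap w).card

theorem heapLength_mul_letter (w : LocallyFreeGroup m) (k : ZMod m) (s : ℤˣ) :
    (Cancels (toHeap w) k s ∧ heapLength (w * letter k s) + 1 = heapLength w) ∨
    (¬ Cancels (toHeap w) k s ∧ heapLength (w * letter k s) = heapLength w + 1) := by
  unfold heapLength
  rw [toHeap_mul_letter, (isHeap_toHeap w).dropPiece_eq]
  split_ifs with h
  · exact Or.inl ⟨h, (isHeap_toHeap w).card_pop h.1⟩
  · exact Or.inr ⟨h, card_push⟩

theorem Reduced.toHeap_eq {w : LocallyFreeGroup m} (h : Reduced H w) : toHeap w = H := by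
  induction h with
  | empty => exact toHeap_one
  | add k s _ hc ih => rw [toHeap_mul_letter, ih, dropPiece_of_not_cancels hc]

/-- When a ground piece arrives, no piece lies in its own or an adjacent column, so its letter
commutes past the whole word before it and moves to the front. -/
theorem Reduced.exists_eq_letter_mul {w : LocallyFreeGroup m} (h : Reduced H w)
    (hp : (⟨1, j, t⟩ : Piece m) ∈ H) :
    ∃ v, w = letter j t * v ∧ heapLength v + 1 ≤ H.card := by
  induction h with
  | empty => simp at hp
  | @add H w k r h hn ih =>
    rcases Finset.mem_insert.1 hp with he | hp
    · simp only [Piece.mk.injEq] at he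
      obtain ⟨he, rfl, rfl⟩ := he
      have := empty_of_restHeight_eq_one h.isHeap he.symm
      refine ⟨w, (h.commute_letter_of_empty this).eq, ?_⟩
      rw [card_push, heapLength, h.toHeap_eq]
    · obtain ⟨v, rfl, hv⟩ := ih hp
      refine ⟨v * letter k r, (mul_assoc _ _ _), ?_⟩
      rw [card_push]
      rcases heapLength_mul_letter v k r with h | h <;> omega

/-- Follow the words for `w` and for `letter j t * w` in parallel: each further letter lengthens the
first and changes the second by ±1. The maximal length is reached only if the second word never
cancels, and then the initial ground piece survives. -/
theorem Reduced.heapLength_letter_mul {w : LocallyFreeGroup m} (h : Reduced H w)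
    (j : ZMod m) (t : ℤˣ) :
    heapLength (letter j t * w) ≤ H.card + 1 ∧ Odd (heapLength (letter j t * w) + H.card) ∧
    (heapLength (letter j t * w) = H.card + 1 → (⟨1, j, t⟩ : Piece m) ∈ toHeap (letter j t * w)) := by
  induction h with
  | empty =>
    have h0 : ¬ Cancels (∅ : Finset (Piece m)) j t := fun h => by simpa using h.2
    have h1 : toHeap (letter j t) = {⟨1, j, t⟩} := by
      have h2 := toHeap_mul_letter 1 j t
      rw [one_mul, toHeap_one, dropPiece_of_not_cancels h0] at h2
      rw [h2]
      have h3 : restHeight (∅ : Finset (Piece m)) j = 1 := by simp [restHeight, colHeight]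
      rw [push, h3]; rfl
    simp [heapLength, h1]
  | @add H w k r h hn ih =>
    obtain ⟨h1, h2, h3⟩ := ih
    rw [← mul_assoc, card_push]
    rcases heapLength_mul_letter (letter j t * w) k r with h | h
    · refine ⟨by omega, by grind, fun h' => by omega⟩
    · refine ⟨by omega, by grind, fun h' => ?_⟩
      rw [toHeap_mul_letter, dropPiece_of_not_cancels h.1]
      exact Finset.mem_insert_of_mem (h3 (by omega))

/-- Left multiplication by a letter removes a piece from the heap exactly when the inverse letter
lies on the ground. -/
theorem heapLength_letter_mul (w : LocallyFreeGroup m) (j : ZMod m) (t : ℤˣ) :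
    (heapLength (letter j t * w) : ℝ) - heapLength w =
      1 - 2 * if (⟨1, j, -t⟩ : Piece m) ∈ toHeap w then 1 else 0 := by
  have hw := reduced_toHeap w
  obtain ⟨h1, h2, -⟩ := hw.heapLength_letter_mul j t
  -- Apply the same estimate on the way back from `letter j t * w` to `w`; its equality case shows
  -- that shortening requires the inverse letter on the ground of `w`.
  have hx := reduced_toHeap (letter j t * w)
  obtain ⟨h3, -, h4⟩ := hx.heapLength_letter_mul j (-t)
  rw [letter_neg, inv_mul_cancel_left] at h3 h4
  change heapLength (letter j t * w) ≤ heapLength w + 1 at h1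
  change Odd (heapLength (letter j t * w) + heapLength w) at h2
  change heapLength w ≤ heapLength (letter j t * w) + 1 at h3
  change heapLength w = heapLength (letter j t * w) + 1 → _ at h4
  split_ifs with hp
  · obtain ⟨v, hv, h5⟩ := hw.exists_eq_letter_mul hp
    change heapLength v + 1 ≤ heapLength w at h5
    have h6 : letter j t * w = v := by rw [hv, letter_neg, mul_inv_cancel_left]
    rw [h6] at h3 ⊢
    have : heapLength w = heapLength v + 1 := by omega
    rw [this]; push_cast; ring
  · have : heapLength (letter j t * w) = heapLength w + 1 := by
      rcases Nat.lt_trichotomy (heapLength (letter j t * w)) (heapLength w) with h | h | h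
      · exact absurd (h4 (by omega)) hp
      · rw [h] at h2; grind
      · omega
    rw [this]; push_cast; ring

end GroupAction

/-! ### Exposed, stacked, covering and fresh columns, and how they change. -/

section LocalStructure

variable {m : ℕ} {H : Finset (Piece m)} {i j k : ZMod m} {s t : ℤˣ} {e : ZMod m}

/-- Indicator of the exposed columns. -/
def exposure (H : Finset (Piece m)) (k : ZMod m) : ℤ := if Exposed H k then 1 else 0

/-- Indicator of the exposed columns that stay exposed when their highest piece is removed. -/
def stacked (H : Finset (Piece m)) (k : ZMod m) : ℤ := exposure H k * exposure (pop H k) k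

/-- Indicator of the exposed columns `k` for which removing the highest piece exposes `k + e`. -/
def covering (e : ZMod m) (H : Finset (Piece m)) (k : ZMod m) : ℤ :=
  exposure H k * exposure (pop H k) (k + e)

/-- Indicator of the exposed columns that are not stacked. -/
def fresh (H : Finset (Piece m)) (k : ZMod m) : ℤ := exposure H k - stacked H k

theorem exposure_eq : exposure H k = 0 ∨ exposure H k = 1 := by
  unfold exposure; split_ifs <;> simp

theorem exposure_eq_one : exposure H k = 1 ↔ Exposed H k := by
  unfold exposure; split_ifs with h <;> simp [h]

theorem exposure_eq_zero : exposure H k = 0 ↔ ¬ Exposed H k := by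
  unfold exposure; split_ifs with h <;> simp [h]

theorem exposure_congr {G : Finset (Piece m)} (h : Exposed G j ↔ Exposed H k) :
    exposure G j = exposure H k := by
  unfold exposure; simp [h]

theorem stacked_eq : stacked H k = 0 ∨ stacked H k = 1 := by
  unfold stacked
  rcases exposure_eq (H := H) (k := k) with h | h <;> rw [h] <;> simp [exposure_eq]

theorem covering_eq : covering e H k = 0 ∨ covering e H k = 1 := by
  unfold covering
  rcases exposure_eq (H := H) (k := k) with h | h <;> rw [h] <;> simp [exposure_eq]

theorem exposure_add_succ : exposure H k + exposure H (k + 1) ≤ 1 := by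
  rcases exposure_eq (H := H) (k := k) with h | h
  · rcases exposure_eq (H := H) (k := k + 1) with h' | h' <;> omega
  · have := not_exposed_succ (exposure_eq_one.1 h)
    rw [exposure_eq_zero.2 this]; omega

theorem exposure_add_unit (he : e = 1 ∨ e = -1) : exposure H k + exposure H (k + e) ≤ 1 := by
  rcases he with rfl | rfl
  · exact exposure_add_succ
  · have := exposure_add_succ (H := H) (k := k + -1)
    rw [neg_add_cancel_right] at this; omega

/-- After the removal the adjacent columns `k` and `k + e` cannot both be exposed. -/
theorem stacked_add_covering (he : e = 1 ∨ e = -1) :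
    stacked H k + covering e H k ≤ exposure H k := by
  have := exposure_add_unit (H := pop H k) (k := k) he
  unfold stacked covering
  rcases exposure_eq (H := H) (k := k) with h | h <;> rw [h] <;> omega

theorem fresh_add_stacked : fresh H k + stacked H k = exposure H k := by
  unfold fresh; ring

theorem fresh_eq : fresh H k = 0 ∨ fresh H k = 1 := by
  have h := stacked_add_covering (H := H) (k := k) (e := 1) (Or.inl rfl)
  have h1 := covering_eq (H := H) (k := k) (e := 1)
  have h2 := stacked_eq (H := H) (k := k)
  have h3 := exposure_eq (H := H) (k := k)
  unfold fresh; omega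

variable [hm : Fact (4 ≤ m)]

theorem unit_ne_zero (he : e = 1 ∨ e = -1) : e ≠ 0 := by
  rcases he with rfl | rfl <;> simpa using zmod_one_ne_zero

theorem two_unit_ne_zero (he : e = 1 ∨ e = -1) : 2 * e ≠ 0 := by
  rcases he with rfl | rfl <;> simpa using zmod_two_ne_zero

theorem three_unit_ne_zero (he : e = 1 ∨ e = -1) : 3 * e ≠ 0 := by
  rcases he with rfl | rfl <;> simpa using zmod_three_ne_zero

omit hm in
theorem closeCols_iff_unit (he : e = 1 ∨ e = -1) :
    CloseCols j k ↔ j = k - e ∨ j = k ∨ j = k + e := by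
  unfold CloseCols
  rcases he with rfl | rfl
  · rfl
  · rw [sub_neg_eq_add, ← sub_eq_add_neg]; tauto

theorem not_closeCols_two (he : e = 1 ∨ e = -1) : ¬ CloseCols (k + 2 * e) k := by
  rw [closeCols_iff_unit he]
  rintro (h | h | h)
  · exact three_unit_ne_zero he (by linear_combination h)
  · exact two_unit_ne_zero he (by linear_combination h)
  · exact unit_ne_zero he (by linear_combination h)

theorem not_closeCols_neg_two (he : e = 1 ∨ e = -1) : ¬ CloseCols (k - 2 * e) k := by
  rw [closeCols_iff_unit he]
  rintro (h | h | h)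
  · exact unit_ne_zero he (by linear_combination -h)
  · exact two_unit_ne_zero he (by linear_combination -h)
  · exact three_unit_ne_zero he (by linear_combination -h)

/-- Removal at `k` does not affect the exposure of `k + 2e`, which would be adjacent to the newly
exposed `k + e`. -/
theorem covering_add_two (he : e = 1 ∨ e = -1) :
    covering e H k + exposure H (k + 2 * e) ≤ 1 := by
  have h1 := exposure_add_unit (H := pop H k) (k := k + e) he
  rw [show k + e + e = k + 2 * e by ring,
    exposure_congr (exposed_pop_far (not_closeCols_two he))] at h1
  have h2 := exposure_eq (H := H) (k := k + 2 * e)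
  unfold covering
  rcases exposure_eq (H := H) (k := k) with h | h <;> rw [h] <;> omega

/-- Performing both removals would expose the adjacent columns `k + e` and `k + 2e`. -/
theorem covering_add_covering (he : e = 1 ∨ e = -1) :
    covering e H k + covering (-e) H (k + 3 * e) ≤ 1 := by
  by_contra hc
  have h1 : covering e H k = 1 := by
    have := covering_eq (H := H) (k := k) (e := e)
    have := covering_eq (H := H) (k := k + 3 * e) (e := -e); omega
  have h2 : covering (-e) H (k + 3 * e) = 1 := by
    have := covering_eq (H := H) (k := k + 3 * e) (e := -e); omega
  have h3 : exposure (pop H k) (k + e) = 1 := by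
    unfold covering at h1
    rcases exposure_eq (H := pop H k) (k := k + e) with h | h
    · rw [h] at h1; simp at h1
    · exact h
  have h4 : exposure (pop H (k + 3 * e)) (k + 3 * e + -e) = 1 := by
    unfold covering at h2
    rcases exposure_eq (H := pop H (k + 3 * e)) (k := k + 3 * e + -e) with h | h
    · rw [h] at h2; simp at h2
    · exact h
  have h5 : ¬ CloseCols (k + e) (k + 3 * e) := by
    have := not_closeCols_neg_two (k := k + 3 * e) he
    rwa [show k + 3 * e - 2 * e = k + e by ring] at this
  have h6 : ¬ CloseCols (k + 2 * e) k := not_closeCols_two he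
  rw [show k + 3 * e + -e = k + 2 * e by ring] at h4
  have h7 : exposure (pop (pop H k) (k + 3 * e)) (k + e) = 1 := by
    rw [exposure_congr (exposed_pop_far h5), h3]
  have h8 : exposure (pop (pop H (k + 3 * e)) k) (k + 2 * e) = 1 := by
    rw [exposure_congr (exposed_pop_far h6), h4]
  rw [pop_pop_comm (fun h => three_unit_ne_zero he (by linear_combination h))] at h8
  have h9 := exposure_add_unit (H := pop (pop H k) (k + 3 * e)) (k := k + e) he
  rw [show k + e + e = k + 2 * e by ring] at h9
  omega

/-! ### Effect of an addition -/

theorem exposure_push_self : exposure (push H j s) j = 1 :=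
  exposure_eq_one.2 exposed_push_self

theorem exposure_push_unit (he : e = 1 ∨ e = -1) : exposure (push H j s) (j + e) = 0 := by
  have := exposure_add_unit (H := push H j s) (k := j) he
  rw [exposure_push_self] at this
  rcases exposure_eq (H := push H j s) (k := j + e) with h | h <;> omega

omit hm in
theorem exposure_push_far (h : ¬ CloseCols i j) : exposure (push H j s) i = exposure H i :=
  exposure_congr (exposed_push_far h)

theorem stacked_push_self : stacked (push H j s) j = exposure H j := by
  rw [stacked, exposure_push_self, pop_push_self, one_mul]

theorem stacked_push_unit (he : e = 1 ∨ e = -1) : stacked (push H j s) (j + e) = 0 := by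
  rw [stacked, exposure_push_unit he, zero_mul]

omit hm in
theorem stacked_push_far (h : ¬ CloseCols i j) : stacked (push H j s) i = stacked H i := by
  rw [stacked, pop_push_far h, exposure_push_far h, exposure_push_far h, stacked]

theorem fresh_push_self : fresh (push H j s) j = 1 - exposure H j := by
  rw [fresh, exposure_push_self, stacked_push_self]

theorem fresh_push_unit (he : e = 1 ∨ e = -1) : fresh (push H j s) (j + e) = 0 := by
  rw [fresh, exposure_push_unit he, stacked_push_unit he, sub_zero]

omit hm in
theorem fresh_push_far (h : ¬ CloseCols i j) : fresh (push H j s) i = fresh H i := by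
  rw [fresh, exposure_push_far h, stacked_push_far h, fresh]

theorem covering_push_self : covering e (push H j s) j = exposure H (j + e) := by
  rw [covering, exposure_push_self, pop_push_self, one_mul]

theorem covering_push_unit {d : ZMod m} (he : e = 1 ∨ e = -1) :
    covering d (push H j s) (j + e) = 0 := by
  rw [covering, exposure_push_unit he, zero_mul]

theorem covering_push_two (he : e = 1 ∨ e = -1) :
    covering e (push H j s) (j - 2 * e) = 0 := by
  have h := covering_add_two (H := push H j s) (k := j - 2 * e) he
  rw [sub_add_cancel, exposure_push_self] at h
  rcases covering_eq (H := push H j s) (k := j - 2 * e) (e := e) with h' | h' <;> omega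

omit hm in
theorem not_close_add_of_ne (he : e = 1 ∨ e = -1) (h : ¬ CloseCols i j) (h' : i ≠ j - 2 * e) :
    ¬ CloseCols (i + e) j := by
  rw [closeCols_iff_unit he] at *
  rintro (h1 | h1 | h1)
  · exact h' (by linear_combination h1)
  · exact h (Or.inl (by linear_combination h1))
  · exact h (Or.inr (Or.inl (by linear_combination h1)))

-- The exception `j - 2e` is needed because its covering tests the exposure of `j - e`, a neighbour
-- of the changed column.
omit hm in
theorem covering_push_far (he : e = 1 ∨ e = -1) (h : ¬ CloseCols i j) (h' : i ≠ j - 2 * e) :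
    covering e (push H j s) i = covering e H i := by
  rw [covering, pop_push_far h, exposure_push_far h,
    exposure_push_far (not_close_add_of_ne he h h'), covering]

/-! ### Effect of a removal -/

omit hm in
theorem exposure_pop_self (hx : exposure H j = 1) : exposure (pop H j) j = stacked H j := by
  rw [stacked, hx, one_mul]

omit hm in
theorem exposure_pop_add (hx : exposure H j = 1) :
    exposure (pop H j) (j + e) = covering e H j := by
  rw [covering, hx, one_mul]

omit hm in
theorem exposure_pop_far (h : ¬ CloseCols i j) : exposure (pop H j) i = exposure H i :=
  exposure_congr (exposed_pop_far h)

omit hm in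
theorem stacked_pop_far (h : ¬ CloseCols i j) : stacked (pop H j) i = stacked H i := by
  rw [stacked, pop_pop_comm (ne_of_not_close h).2.1.symm, exposure_pop_far h,
    exposure_pop_far h, stacked]

omit hm in
theorem fresh_pop_far (h : ¬ CloseCols i j) : fresh (pop H j) i = fresh H i := by
  rw [fresh, exposure_pop_far h, stacked_pop_far h, fresh]

omit hm in
theorem covering_pop_far (he : e = 1 ∨ e = -1) (h : ¬ CloseCols i j) (h' : i ≠ j - 2 * e) :
    covering e (pop H j) i = covering e H i := by
  rw [covering, pop_pop_comm (ne_of_not_close h).2.1.symm, exposure_pop_far h,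
    exposure_pop_far (not_close_add_of_ne he h h'), covering]

theorem covering_two_eq_zero (he : e = 1 ∨ e = -1) (hx : exposure H j = 1) :
    covering e H (j - 2 * e) = 0 := by
  have h := covering_add_two (H := H) (k := j - 2 * e) he
  rw [sub_add_cancel, hx] at h
  rcases covering_eq (H := H) (k := j - 2 * e) (e := e) with h' | h' <;> omega

omit hm in
theorem exposure_unit_eq_zero (he : e = 1 ∨ e = -1) (hx : exposure H j = 1) :
    exposure H (j + e) = 0 := by
  have h := exposure_add_unit (H := H) (k := j) he
  rcases exposure_eq (H := H) (k := j + e) with h' | h' <;> omega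

end LocalStructure

/-! ### Sums over the cycle whose summand changes only near one column. -/

section Sums

variable {m : ℕ} [NeZero m] [hm : Fact (4 ≤ m)] {j e : ZMod m}

theorem sum_eq_of_eq_far (f g : ZMod m → ℤ) (h : ∀ i, ¬ CloseCols i j → f i = g i) :
    ∑ i, f i = ∑ i, g i + (f (j - 1) - g (j - 1)) + (f j - g j) + (f (j + 1) - g (j + 1)) := by
  have h2 : ∑ i, (f i - g i) = ∑ i ∈ {j - 1, j, j + 1}, (f i - g i) := by
    refine (Finset.sum_subset (Finset.subset_univ _) fun i _ hi => ?_).symm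
    rw [h i (by simpa [CloseCols] using hi), sub_self]
  have h3 : j - 1 ≠ j + 1 := fun h => zmod_two_ne_zero (m := m) (by linear_combination -h)
  rw [Finset.sum_insert (by simpa [h3] using (col_pred_ne j)),
    Finset.sum_pair (col_succ_ne j).symm, Finset.sum_sub_distrib] at h2
  linarith

theorem sum_eq_of_eq_far' (he : e = 1 ∨ e = -1) (f g : ZMod m → ℤ)
    (h : ∀ i, ¬ CloseCols i j → i ≠ j - 2 * e → f i = g i) :
    ∑ i, f i = ∑ i, g i + (f (j - 1) - g (j - 1)) + (f j - g j) + (f (j + 1) - g (j + 1)) +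
      (f (j - 2 * e) - g (j - 2 * e)) := by
  have h1 := sum_eq_of_eq_far (j := j) (fun i => if i = j - 2 * e then g i else f i) g
    (fun i hi => by
      split_ifs with h'
      · rfl
      · exact h i hi h')
  have h2 : ∑ i, (f i - if i = j - 2 * e then g i else f i) = f (j - 2 * e) - g (j - 2 * e) := by
    rw [Finset.sum_eq_single (j - 2 * e)]
    · simp
    · intro i _ hi; simp [hi]
    · simp
  rw [Finset.sum_sub_distrib] at h2
  have hn := not_closeCols_neg_two (k := j) he
  have n1 : j - 1 ≠ j - 2 * e := fun h => hn (h ▸ Or.inl rfl)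
  have n2 : j ≠ j - 2 * e := fun h => hn (h ▸ Or.inr (Or.inl rfl))
  have n3 : j + 1 ≠ j - 2 * e := fun h => hn (h ▸ Or.inr (Or.inr rfl))
  simp only [n1, n2, n3, if_false] at h1
  linarith

omit hm in
theorem sum_shift (f : ZMod m → ℤ) (d : ZMod m) : ∑ i, f (i + d) = ∑ i, f i :=
  Equiv.sum_comp (Equiv.addRight d) f

variable (m) in
/-- How often two columns at distance two have two common neighbours. -/
def wrap : ℤ := if m = 4 then 2 else 1

/-- Change of `∑ k, a k * a (k + 2)` when `a` changes only near column `j`. -/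
theorem sum_mul_two_of_eq_far (a b : ZMod m → ℤ) (h : ∀ i, ¬ CloseCols i j → b i = a i) :
    ∑ i, b i * b (i + 2) = ∑ i, a i * a (i + 2)
      + (b (j - 1) - a (j - 1)) * (a (j + 1) + a (j - 3))
      + (b j - a j) * (a (j + 2) + a (j - 2))
      + (b (j + 1) - a (j + 1)) * (a (j + 3) + a (j - 1))
      + wrap m * ((b (j - 1) - a (j - 1)) * (b (j + 1) - a (j + 1))) := by
  set d : ZMod m → ℤ := fun i => b i - a i with hd
  have hd0 : ∀ i, ¬ CloseCols i j → d i = 0 := fun i hi => by simp [hd, h i hi]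
  have e1 : ∑ i, b i * b (i + 2) = ∑ i, a i * a (i + 2) + ∑ i, d i * (a (i + 2) + a (i - 2))
      + ∑ i, d i * d (i + 2) := by
    have := sum_shift (fun i => d i * a (i - 2)) 2
    simp only [add_sub_cancel_right] at this
    simp only [mul_add, Finset.sum_add_distrib]
    rw [← this, ← Finset.sum_add_distrib, ← Finset.sum_add_distrib, ← Finset.sum_add_distrib]
    exact Finset.sum_congr rfl fun i _ => by simp only [hd]; ring
  have e2 := sum_eq_of_eq_far (j := j) (fun i => d i * (a (i + 2) + a (i - 2))) (fun _ => 0)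
    (fun i hi => by simp [hd0 i hi])
  have e3 : ∑ i, d i * d (i + 2) = wrap m * (d (j - 1) * d (j + 1)) := by
    have e4 := sum_eq_of_eq_far (j := j) (fun i => d i * d (i + 2)) (fun _ => 0)
      (fun i hi => by simp [hd0 i hi])
    have e5 : d (j + 2) = 0 := hd0 _ (by simpa using not_closeCols_two (k := j) (Or.inl rfl))
    simp only [Finset.sum_const_zero, zero_add, sub_zero, e5, mul_zero, add_zero,
      show j - 1 + 2 = j + 1 by ring, show j + 1 + 2 = j + 3 by ring] at e4
    rw [e4]
    -- For m = 4 the column `j + 3` is `j - 1`, so the pair is met a second time; for larger m it is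
    -- far from `j` and contributes nothing.
    unfold wrap
    split_ifs with h4
    · have : (3 : ZMod m) = -1 := by subst h4; rfl
      rw [this, ← sub_eq_add_neg]; ring
    · have : d (j + 3) = 0 := by
        refine hd0 _ fun hc => ?_
        rcases hc with hc | hc | hc
        · have h5 : ((4 : ℕ) : ZMod m) = 0 := by push_cast; linear_combination hc
          have := hm.out
          exact natCast_zmod_ne_zero (by omega) (by omega) h5
        · exact zmod_three_ne_zero (m := m) (by linear_combination hc)
        · exact zmod_two_ne_zero (m := m) (by linear_combination hc)
      rw [this]; ring
  rw [e1, e2, e3]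
  simp only [Finset.sum_const_zero, hd, show j - 1 + 2 = j + 1 by ring,
    show j - 1 - 2 = j - 3 by ring, show j + 1 + 2 = j + 3 by ring,
    show j + 1 - 2 = j - 1 by ring]
  ring

end Sums

/-! ### The potential and its change under one drop. -/

section Potential

variable {m : ℕ} [NeZero m] [hm : Fact (4 ≤ m)] {H : Finset (Piece m)} {i j k : ZMod m} {s : ℤˣ}

/-- A local functional of the top of the heap. -/
def potential (α β γ δ : ℤ) (H : Finset (Piece m)) : ℤ :=
  α * ∑ k, exposure H k + β * ∑ k, stacked H k
    + γ * (∑ k, covering 1 H k + ∑ k, covering (-1) H k)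
    + δ * ∑ k, fresh H k * fresh H (k + 2)

/-- Stacked columns revealed by a removal in column `j`. -/
def revealedStacked (H : Finset (Piece m)) (j : ZMod m) : ℤ :=
  exposure H j * (stacked (pop H j) (j - 1) + stacked (pop H j) j + stacked (pop H j) (j + 1))

/-- Covering columns revealed by a removal in column `j`. -/
def revealedCovering (e : ZMod m) (H : Finset (Piece m)) (j : ZMod m) : ℤ :=
  exposure H j * (covering e (pop H j) (j - 1) + covering e (pop H j) j
    + covering e (pop H j) (j + 1) + covering e (pop H j) (j - 2 * e))

/-- Pairs of fresh columns at distance two revealed by a removal in column `j`. -/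
def revealedPairs (H : Finset (Piece m)) (j : ZMod m) : ℤ :=
  exposure H j * (fresh (pop H j) j * (fresh H (j + 2) + fresh H (j - 2))
    + fresh (pop H j) (j - 1) * fresh H (j - 3) + fresh (pop H j) (j + 1) * fresh H (j + 3)
    + wrap m * (fresh (pop H j) (j - 1) * fresh (pop H j) (j + 1)))

omit [NeZero m] hm in
theorem stacked_of_not_exposed (h : exposure H k = 0) : stacked H k = 0 := by
  rw [stacked, h, zero_mul]

omit [NeZero m] hm in
theorem covering_of_not_exposed {e : ZMod m} (h : exposure H k = 0) : covering e H k = 0 := by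
  rw [covering, h, zero_mul]

omit [NeZero m] hm in
theorem fresh_of_not_exposed (h : exposure H k = 0) : fresh H k = 0 := by
  rw [fresh, stacked_of_not_exposed h, h, sub_zero]

omit [NeZero m] hm in
theorem pred_eq (j : ZMod m) : j - 1 = j + -1 := sub_eq_add_neg _ _

theorem potential_push (α β γ δ : ℤ) :
    potential α β γ δ (push H j s) - potential α β γ δ H =
      α * (1 - exposure H j - exposure H (j - 1) - exposure H (j + 1))
      + β * (exposure H j - stacked H j - stacked H (j - 1) - stacked H (j + 1))
      + γ * ((exposure H (j + 1) - covering 1 H j - covering 1 H (j - 1) - covering 1 H (j + 1)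
          - covering 1 H (j - 2))
        + (exposure H (j - 1) - covering (-1) H j - covering (-1) H (j - 1)
          - covering (-1) H (j + 1) - covering (-1) H (j + 2)))
      + δ * ((1 - exposure H j - fresh H j) * (fresh H (j + 2) + fresh H (j - 2))
        - fresh H (j - 1) * (fresh H (j + 1) + fresh H (j - 3))
        - fresh H (j + 1) * (fresh H (j + 3) + fresh H (j - 1))
        + wrap m * (fresh H (j - 1) * fresh H (j + 1))) := by
  have u1 : (1 : ZMod m) = 1 ∨ (1 : ZMod m) = -1 := Or.inl rfl
  have u2 : (-1 : ZMod m) = 1 ∨ (-1 : ZMod m) = -1 := Or.inr rfl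
  have hx := sum_eq_of_eq_far (j := j) (exposure (push H j s)) (exposure H)
    fun i hi => exposure_push_far hi
  have hs := sum_eq_of_eq_far (j := j) (stacked (push H j s)) (stacked H)
    fun i hi => stacked_push_far hi
  have hc := sum_eq_of_eq_far' (j := j) u1 (covering 1 (push H j s)) (covering 1 H)
    fun i hi hi' => covering_push_far u1 hi hi'
  have hd := sum_eq_of_eq_far' (j := j) u2 (covering (-1) (push H j s)) (covering (-1) H)
    fun i hi hi' => covering_push_far u2 hi hi'
  have hq := sum_mul_two_of_eq_far (j := j) (fresh H) (fresh (push H j s))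
    fun i hi => fresh_push_far hi
  -- The new piece exposes column `j`, so `j ∓ 2` can no longer cover the column between.
  rw [covering_push_two u1] at hc
  rw [covering_push_two u2] at hd
  simp only [pred_eq, exposure_push_self, exposure_push_unit u1, exposure_push_unit u2] at hx
  simp only [pred_eq, stacked_push_self, stacked_push_unit u1, stacked_push_unit u2] at hs
  simp only [pred_eq, covering_push_self, covering_push_unit u1, covering_push_unit u2] at hc hd
  simp only [pred_eq, fresh_push_self, fresh_push_unit u1, fresh_push_unit u2] at hq
  unfold potential
  rw [hx, hs, hc, hd, hq]
  simp only [pred_eq, show j - 2 * -1 = j + 2 by ring, mul_one]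
  ring

theorem potential_pop (α β γ δ : ℤ) (h : exposure H j = 1) :
    potential α β γ δ (pop H j) - potential α β γ δ H =
      α * (stacked H j + covering 1 H j + covering (-1) H j - 1)
      + β * (revealedStacked H j - stacked H j)
      + γ * ((revealedCovering 1 H j - covering 1 H j)
        + (revealedCovering (-1) H j - covering (-1) H j))
      + δ * (revealedPairs H j - fresh H j * (fresh H (j + 2) + fresh H (j - 2))) := by
  have u1 : (1 : ZMod m) = 1 ∨ (1 : ZMod m) = -1 := Or.inl rfl
  have u2 : (-1 : ZMod m) = 1 ∨ (-1 : ZMod m) = -1 := Or.inr rfl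
  have z1 := exposure_unit_eq_zero u1 h
  have z2 := exposure_unit_eq_zero u2 h
  rw [← pred_eq] at z2
  have hx := sum_eq_of_eq_far (j := j) (exposure (pop H j)) (exposure H)
    fun i hi => exposure_pop_far hi
  have hs := sum_eq_of_eq_far (j := j) (stacked (pop H j)) (stacked H)
    fun i hi => stacked_pop_far hi
  have hc := sum_eq_of_eq_far' (j := j) u1 (covering 1 (pop H j)) (covering 1 H)
    fun i hi hi' => covering_pop_far u1 hi hi'
  have hd := sum_eq_of_eq_far' (j := j) u2 (covering (-1) (pop H j)) (covering (-1) H)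
    fun i hi hi' => covering_pop_far u2 hi hi'
  have hq := sum_mul_two_of_eq_far (j := j) (fresh H) (fresh (pop H j))
    fun i hi => fresh_pop_far hi
  have p2 : exposure (pop H j) (j - 1) = covering (-1) H j := by
    rw [pred_eq, exposure_pop_add h]
  rw [exposure_pop_self h, exposure_pop_add h, p2, h, z1, z2] at hx
  rw [stacked_of_not_exposed z1, stacked_of_not_exposed z2] at hs
  rw [covering_of_not_exposed z1, covering_of_not_exposed z2, covering_two_eq_zero u1 h] at hc
  rw [covering_of_not_exposed z1, covering_of_not_exposed z2, covering_two_eq_zero u2 h] at hd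
  rw [fresh_of_not_exposed z1, fresh_of_not_exposed z2] at hq
  unfold potential revealedStacked revealedCovering revealedPairs
  rw [hx, hs, hc, hd, hq, h]
  ring

/-- The expected change of the potential under a drop in column `j`, summed over both signs. -/
theorem IsHeap.sum_sign_potential (hH : IsHeap H) (α β γ δ : ℤ) (j : ZMod m) :
    ∑ s : ℤˣ, (potential α β γ δ (dropPiece H j s) - potential α β γ δ H) =
      α * (2 - 3 * exposure H j - 2 * (exposure H (j - 1) + exposure H (j + 1))
        + stacked H j + covering 1 H j + covering (-1) H j)
      + β * (exposure H j - 2 * stacked H j - 2 * (stacked H (j - 1) + stacked H (j + 1))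
        + revealedStacked H j)
      + γ * ((2 * exposure H (j + 1) - 2 * covering 1 H j - 2 * covering 1 H (j - 1)
          - 2 * covering 1 H (j + 1) - 2 * covering 1 H (j - 2) + revealedCovering 1 H j)
        + (2 * exposure H (j - 1) - 2 * covering (-1) H j - 2 * covering (-1) H (j - 1)
          - 2 * covering (-1) H (j + 1) - 2 * covering (-1) H (j + 2)
          + revealedCovering (-1) H j))
      + δ * (2 * (1 - exposure H j - fresh H j) * (fresh H (j + 2) + fresh H (j - 2))
        - 2 * (fresh H (j - 1) * fresh H (j - 3)) - 2 * (fresh H (j + 1) * fresh H (j + 3))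
        - (4 - 2 * wrap m) * (fresh H (j - 1) * fresh H (j + 1))
        + revealedPairs H j) := by
  have u1 : (1 : ZMod m) = 1 ∨ (1 : ZMod m) = -1 := Or.inl rfl
  have u2 : (-1 : ZMod m) = 1 ∨ (-1 : ZMod m) = -1 := Or.inr rfl
  rw [hH.sum_sign j (f := fun G => potential α β γ δ G - potential α β γ δ H)
    (fun s _ => potential_push α β γ δ)
    (fun h => potential_pop α β γ δ (exposure_eq_one.2 h))]
  -- One polynomial serves both cases: an exposed column has unexposed neighbours, which kills the
  -- extra terms, while in an unexposed one the removal terms vanish.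
  split_ifs with hx
  · have h := exposure_eq_one.2 hx
    have z1 := exposure_unit_eq_zero u1 h
    have z2 := exposure_unit_eq_zero u2 h
    have c1 := covering_two_eq_zero u1 h
    have c2 := covering_two_eq_zero u2 h
    rw [← pred_eq] at z2
    rw [mul_one] at c1
    rw [show j - 2 * -1 = j + 2 by ring] at c2
    rw [stacked_of_not_exposed z1, stacked_of_not_exposed z2, covering_of_not_exposed z1,
      covering_of_not_exposed z2, covering_of_not_exposed z1, covering_of_not_exposed z2,
      fresh_of_not_exposed z1, fresh_of_not_exposed z2, z1, z2, c1, c2, h]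
    ring
  · have h := exposure_eq_zero.2 hx
    unfold revealedStacked revealedCovering revealedPairs
    rw [stacked_of_not_exposed h, covering_of_not_exposed h, covering_of_not_exposed h,
      fresh_of_not_exposed h, h]
    ring

/-- The contribution of column `k` to the drift of the potential. -/
def siteDrift (α β γ δ : ℤ) (H : Finset (Piece m)) (k : ZMod m) : ℤ :=
  α * (2 - 7 * exposure H k + stacked H k + covering 1 H k + covering (-1) H k)
    + β * (exposure H k - 6 * stacked H k + revealedStacked H k)
    + γ * (4 * exposure H k - 8 * (covering 1 H k + covering (-1) H k)
      + revealedCovering 1 H k + revealedCovering (-1) H k)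
    + δ * (4 * fresh H k - (8 - wrap m) * (fresh H k * (fresh H (k + 2) + fresh H (k - 2)))
      - 2 * (fresh H k * (stacked H (k + 2) + stacked H (k - 2))) + revealedPairs H k)

omit hm in
theorem sum_shift_sub (f : ZMod m → ℤ) (d : ZMod m) : ∑ i, f (i - d) = ∑ i, f i :=
  Equiv.sum_comp (Equiv.subRight d) f

theorem IsHeap.sum_potential (hH : IsHeap H) (α β γ δ : ℤ) :
    ∑ x : Step m, (potential α β γ δ (dropPiece H x.1 x.2) - potential α β γ δ H) =
      ∑ k, siteDrift α β γ δ H k := by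
  rw [Fintype.sum_prod_type]
  simp only [hH.sum_sign_potential]
  rw [← sub_eq_zero, ← Finset.sum_sub_distrib]
  have x1 := sum_shift_sub (fun k => exposure H k) 1
  have x2 := sum_shift (fun k => exposure H k) 1
  have s1 := sum_shift_sub (fun k => stacked H k) 1
  have s2 := sum_shift (fun k => stacked H k) 1
  have c1 := sum_shift_sub (fun k => covering 1 H k) 1
  have c2 := sum_shift (fun k => covering 1 H k) 1
  have c3 := sum_shift_sub (fun k => covering 1 H k) 2
  have d1 := sum_shift_sub (fun k => covering (-1) H k) 1
  have d2 := sum_shift (fun k => covering (-1) H k) 1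
  have d3 := sum_shift (fun k => covering (-1) H k) 2
  have a1 := sum_shift_sub (fun k => fresh H k) 2
  have a2 := sum_shift (fun k => fresh H k) 2
  have q0 := sum_shift_sub (fun k => fresh H (k + 2) * fresh H k) 2
  have q1 := sum_shift_sub (fun k => fresh H (k + 2) * fresh H k) 3
  have q2 := sum_shift (fun k => fresh H (k + 2) * fresh H k) 1
  have q3 := sum_shift_sub (fun k => fresh H (k + 2) * fresh H k) 1
  have b1 := sum_shift_sub (fun k => stacked H (k + 2) * fresh H k) 2
  have b2 := sum_shift_sub (fun k => fresh H (k + 2) * stacked H k) 2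
  simp only [sub_add_cancel, show ∀ k : ZMod m, k - 3 + 2 = k - 1 by intro k; ring,
    show ∀ k : ZMod m, k + 1 + 2 = k + 3 by intro k; ring,
    show ∀ k : ZMod m, k - 1 + 2 = k + 1 by intro k; ring] at q0 q1 q2 q3 b1 b2
  have key : ∀ k : ZMod m, exposure H k = fresh H k + stacked H k := fun k =>
    fresh_add_stacked.symm
  unfold siteDrift
  -- By rotation invariance every term is moved to the column to which it belongs; the discrepancy
  -- is a combination of differences of translates, each with sum zero.
  rw [Finset.sum_congr rfl (g := fun k =>
    (-2 * α + 2 * γ) * (exposure H (k - 1) - exposure H k)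
    + (-2 * α + 2 * γ) * (exposure H (k + 1) - exposure H k)
    + (-2 * β) * (stacked H (k - 1) - stacked H k) + (-2 * β) * (stacked H (k + 1) - stacked H k)
    + (-2 * γ) * (covering 1 H (k - 1) - covering 1 H k)
    + (-2 * γ) * (covering 1 H (k + 1) - covering 1 H k)
    + (-2 * γ) * (covering 1 H (k - 2) - covering 1 H k)
    + (-2 * γ) * (covering (-1) H (k - 1) - covering (-1) H k)
    + (-2 * γ) * (covering (-1) H (k + 1) - covering (-1) H k)
    + (-2 * γ) * (covering (-1) H (k + 2) - covering (-1) H k)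
    + (2 * δ) * (fresh H (k - 2) - fresh H k) + (2 * δ) * (fresh H (k + 2) - fresh H k)
    + ((4 - wrap m) * δ) * (fresh H k * fresh H (k - 2) - fresh H (k + 2) * fresh H k)
    + (-2 * δ) * (fresh H (k - 1) * fresh H (k - 3) - fresh H (k + 2) * fresh H k)
    + (-2 * δ) * (fresh H (k + 3) * fresh H (k + 1) - fresh H (k + 2) * fresh H k)
    + (-(4 - 2 * wrap m) * δ) * (fresh H (k + 1) * fresh H (k - 1) - fresh H (k + 2) * fresh H k)
    + (2 * δ) * (stacked H (k + 2) * fresh H k - stacked H k * fresh H (k - 2))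
    + (2 * δ) * (stacked H (k - 2) * fresh H k - fresh H (k + 2) * stacked H k))
    (fun k _ => by simp only [key]; ring)]
  have b2' : ∑ k, stacked H (k - 2) * fresh H k = ∑ k, fresh H (k + 2) * stacked H k := by
    rw [← b2]; exact Finset.sum_congr rfl fun k _ => mul_comm _ _
  simp only [Finset.sum_add_distrib, ← Finset.mul_sum, Finset.sum_sub_distrib]
  rw [x1, x2, s1, s2, c1, c2, c3, d1, d2, d3, a1, a2, q0, q1, q2, q3, b1, b2']
  ring

end Potential

/-! ### The bound at a single column, for m ≥ 5. -/

section LocalBound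

variable {m : ℕ} {H : Finset (Piece m)} {k e : ZMod m}

omit H k in
theorem unit_neg (he : e = 1 ∨ e = -1) : -e = 1 ∨ -e = -1 := by
  rcases he with rfl | rfl <;> simp

theorem removal_side (he : e = 1 ∨ e = -1) (hx : exposure H k = 1) :
    stacked (pop H k) (k + e) + covering e (pop H k) (k + e) ≤ covering e H k ∧
    stacked (pop H k) (k + e) + covering (-e) (pop H k) (k + e) ≤ covering e H k ∧
    fresh (pop H k) (k + e) = covering e H k - stacked (pop H k) (k + e) := by
  rw [← exposure_pop_add hx]
  exact ⟨stacked_add_covering he, stacked_add_covering (unit_neg he), rfl⟩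

theorem removal_center (he : e = 1 ∨ e = -1) (hx : exposure H k = 1) :
    stacked (pop H k) k + covering e (pop H k) k ≤ stacked H k ∧
    fresh (pop H k) k = stacked H k - stacked (pop H k) k := by
  rw [← exposure_pop_self hx]
  exact ⟨stacked_add_covering he, rfl⟩

theorem siteDrift_of_exposed (α β γ δ : ℤ) (hx : exposure H k = 1) :
    siteDrift α β γ δ H k =
      α * (-5 + stacked H k + covering 1 H k + covering (-1) H k)
      + β * (1 - 6 * stacked H k + (stacked (pop H k) (k + -1) + stacked (pop H k) k
        + stacked (pop H k) (k + 1)))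
      + γ * (4 - 8 * (covering 1 H k + covering (-1) H k)
        + (covering 1 (pop H k) (k + -1) + covering 1 (pop H k) k + covering 1 (pop H k) (k + 1)
          + covering 1 (pop H k) (k - 2 * 1))
        + (covering (-1) (pop H k) (k + -1) + covering (-1) (pop H k) k
          + covering (-1) (pop H k) (k + 1) + covering (-1) (pop H k) (k - 2 * -1)))
      + δ * (4 * fresh H k
        - (8 - wrap m) * (fresh H k * (fresh H (k + 2 * 1) + fresh H (k + 2 * -1)))
        - 2 * (fresh H k * (stacked H (k + 2 * 1) + stacked H (k + 2 * -1)))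
        + (fresh (pop H k) k * (fresh H (k + 2 * 1) + fresh H (k + 2 * -1))
          + fresh (pop H k) (k + -1) * fresh H (k + 3 * -1)
          + fresh (pop H k) (k + 1) * fresh H (k + 3 * 1)
          + wrap m * (fresh (pop H k) (k + -1) * fresh (pop H k) (k + 1)))) := by
  unfold siteDrift revealedStacked revealedCovering revealedPairs
  rw [hx, show k + 2 * -1 = k - 2 by ring, show k + 3 * -1 = k - 3 by ring,
    show k + 2 * 1 = k + 2 by ring, show k + 3 * 1 = k + 3 by ring, ← pred_eq]
  ring

theorem siteDrift_of_not_exposed (α β γ δ : ℤ) (hx : exposure H k = 0) :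
    siteDrift α β γ δ H k = 2 * α := by
  unfold siteDrift revealedStacked revealedCovering revealedPairs
  rw [hx, fresh_of_not_exposed hx, stacked_of_not_exposed hx, covering_of_not_exposed hx,
    covering_of_not_exposed hx]
  ring

theorem stacked_bounds : 0 ≤ stacked H k ∧ stacked H k ≤ 1 := by
  rcases stacked_eq (H := H) (k := k) with h | h <;> omega

theorem covering_bounds : 0 ≤ covering e H k ∧ covering e H k ≤ 1 := by
  rcases covering_eq (H := H) (k := k) (e := e) with h | h <;> omega

theorem fresh_bounds : 0 ≤ fresh H k ∧ fresh H k ≤ 1 := by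
  rcases fresh_eq (H := H) (k := k) with h | h <;> omega

variable [hm : Fact (4 ≤ m)]

theorem removal_center_two (he : e = 1 ∨ e = -1) :
    covering e (pop H k) k + exposure H (k + 2 * e) ≤ 1 := by
  rw [← exposure_pop_far (H := H) (j := k) (not_closeCols_two he)]
  exact covering_add_two he

/-- After removal at `k`, column `k - e` is exposed precisely if `k` covers it, and then `k + e`
cannot uncover `k`. -/
theorem removal_back (he : e = 1 ∨ e = -1) (hx : exposure H k = 1) :
    covering (-e) (pop H k) (k + e) + covering (-e) H k ≤ 1 := by
  have := covering_add_two (H := pop H k) (k := k + e) (unit_neg he)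
  rwa [show k + e + 2 * -e = k + -e by ring, exposure_pop_add hx] at this

/-- These limit how the removal at `k` can turn `k - 2e` into a covering column for `k - e`, until
then blocked by `k`. -/
theorem removal_far (he : e = 1 ∨ e = -1) (hx : exposure H k = 1) :
    covering e (pop H k) (k - 2 * e) + stacked H k ≤ 1 ∧
    covering e (pop H k) (k - 2 * e) ≤ fresh H (k - 2 * e) ∧
    covering e (pop H k) (k - 2 * e) + covering (-e) (pop H k) (k + e) ≤ 1 := by
  refine ⟨?_, ?_, ?_⟩
  · have := covering_add_two (H := pop H k) (k := k - 2 * e) he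
    rwa [sub_add_cancel, exposure_pop_self hx] at this
  · have := stacked_add_covering (H := pop H k) (k := k - 2 * e) he
    rw [← fresh_pop_far (H := H) (j := k) (not_closeCols_neg_two he), fresh]
    omega
  · have := covering_add_covering (H := pop H k) (k := k - 2 * e) he
    rwa [show k - 2 * e + 3 * e = k + e by ring] at this

omit hm in
theorem four_unit_ne_zero (h5 : 5 ≤ m) (he : e = 1 ∨ e = -1) : 4 * e ≠ 0 := by
  have h4 : (4 : ZMod m) ≠ 0 := by
    exact_mod_cast natCast_zmod_ne_zero (m := m) (n := 4) (by omega) (by omega)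
  rcases he with rfl | rfl <;> simpa using h4

/-- Here m ≥ 5 keeps `k + 3e` away from the neighbours of `k`, so that the removal does not change
its exposure. -/
theorem removal_three (h5 : 5 ≤ m) (he : e = 1 ∨ e = -1) :
    covering e (pop H k) (k + e) + exposure H (k + 3 * e) ≤ 1 := by
  have hf : ¬ CloseCols (k + 3 * e) k := by
    rw [closeCols_iff_unit he]
    rintro (h | h | h)
    · exact four_unit_ne_zero h5 he (by linear_combination h)
    · exact three_unit_ne_zero he (by linear_combination h)
    · exact two_unit_ne_zero he (by linear_combination h)
  have := covering_add_two (H := pop H k) (k := k + e) he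
  rwa [show k + e + 2 * e = k + 3 * e by ring, exposure_pop_far hf] at this

theorem removal_four (h5 : 5 ≤ m) (he : e = 1 ∨ e = -1) (hx : exposure H k = 1) :
    covering e (pop H k) (k + e) + covering (-e) H (k + 4 * e) ≤ 1 := by
  have h := covering_add_covering (H := pop H k) (k := k + e) he
  rw [show k + e + 3 * e = k + 4 * e by ring] at h
  by_cases hc : CloseCols (k + 4 * e) k
  -- For m = 5 the column `k + 4e` is `k - e`, which is not exposed.
  · have hz : exposure H (k + 4 * e) = 0 := by
      rcases (closeCols_iff_unit he).1 hc with h | h | h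
      · rw [h, sub_eq_add_neg]; exact exposure_unit_eq_zero (unit_neg he) hx
      · exact absurd (by linear_combination h) (four_unit_ne_zero h5 he)
      · exact absurd (by linear_combination h) (three_unit_ne_zero he)
    rw [covering_of_not_exposed hz]
    rcases covering_eq (H := pop H k) (k := k + e) (e := e) with h | h <;> omega
  · rwa [covering_pop_far (unit_neg he) hc
      (fun h => two_unit_ne_zero he (by linear_combination h))] at h

/-- The share of the columns on side `e` that is attributed to the exposed column `k`. -/
def share (e : ZMod m) (H : Finset (Piece m)) (k : ZMod m) : ℤ :=
  exposure H k * (3 - exposure H (k + 2 * e) + (1 - exposure H (k + 2 * e)) *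
    (1 - exposure H (k + 3 * e)) *
      (2 - exposure H (k + 4 * e) * (1 - covering e H k + covering (-e) H (k + 4 * e))))

omit hm in
theorem share_ge (hx : exposure H k = 1) : 3 - exposure H (k + 2 * e) ≤ share e H k := by
  unfold share
  have h4 := covering_eq (H := H) (k := k) (e := e)
  have h5 := covering_eq (H := H) (k := k + 4 * e) (e := -e)
  rcases exposure_eq (H := H) (k := k + 2 * e) with h | h <;>
  rcases exposure_eq (H := H) (k := k + 3 * e) with h' | h' <;>
  rcases exposure_eq (H := H) (k := k + 4 * e) with h'' | h'' <;>
  rw [hx, h, h', h''] <;> omega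

/-- A covering column gets the larger part of a contested column at distance two. This pays for the
further columns its removal may reveal. -/
theorem share_of_covering (he : e = 1 ∨ e = -1) (hx : exposure H k = 1)
    (hc : covering e H k = 1) :
    share e H k = 3 + (1 - exposure H (k + 3 * e)) * (2 - covering (-e) H (k + 4 * e)) := by
  have h2 : exposure H (k + 2 * e) = 0 := by
    have := covering_add_two (H := H) (k := k) he
    rcases exposure_eq (H := H) (k := k + 2 * e) with h | h <;> omega
  unfold share
  rw [hx, h2, hc]
  rcases exposure_eq (H := H) (k := k + 4 * e) with h | h
  · rw [covering_of_not_exposed h, h]; ring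
  · rw [h]; ring

omit hm in
theorem share_of_not_exposed (hx : exposure H k = 0) : share e H k = 0 := by
  rw [share, hx, zero_mul]

-- The exclusions above are linear inequalities between 0-1 variables, and the weights 314, 62, 47,
-- 9 and the charge 16 are chosen to make the estimate a consequence of them. The constant 628 is
-- twice 314, the contribution of an unexposed column.
set_option maxHeartbeats 1000000 in
theorem siteDrift_le (h5 : 5 ≤ m) :
    2008 * exposure H k + siteDrift 314 62 47 9 H k ≤
      628 + 16 * (share 1 H k + share (-1) H k) := by
  rcases exposure_eq (H := H) (k := k) with hx | hx
  · rw [siteDrift_of_not_exposed _ _ _ _ hx, share_of_not_exposed hx, share_of_not_exposed hx, hx]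
    norm_num
  have u1 : (1 : ZMod m) = 1 ∨ (1 : ZMod m) = -1 := Or.inl rfl
  have u2 : (-1 : ZMod m) = 1 ∨ (-1 : ZMod m) = -1 := Or.inr rfl
  have hw : wrap m = 1 := by unfold wrap; rw [if_neg (by omega)]
  rw [siteDrift_of_exposed _ _ _ _ hx, hw, hx]
  obtain ⟨A1, A2, A3⟩ := removal_side u1 hx
  obtain ⟨B1, B2, B3⟩ := removal_side u2 hx
  obtain ⟨C1, C2⟩ := removal_center u1 hx
  obtain ⟨D1, -⟩ := removal_center u2 hx
  have E1 := removal_center_two (H := H) (k := k) u1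
  have E2 := removal_center_two (H := H) (k := k) u2
  have G1 := removal_back u1 hx
  have G2 := removal_back u2 hx
  obtain ⟨I1, I2, I3⟩ := removal_far u1 hx
  obtain ⟨J1, J2, J3⟩ := removal_far u2 hx
  have K1 := removal_three (H := H) (k := k) h5 u1
  have K2 := removal_three (H := H) (k := k) h5 u2
  have L1 := removal_four h5 u1 hx
  have L2 := removal_four h5 u2 hx
  have M1 := share_ge (e := 1) hx
  have M2 := share_ge (e := -1) hx
  have N1 := fun h => share_of_covering u1 hx h
  have N2 := fun h => share_of_covering u2 hx h
  have O1 := stacked_add_covering (H := H) (k := k) u1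
  have O2 := stacked_add_covering (H := H) (k := k) u2
  have P1 := covering_add_two (H := H) (k := k) u1
  have P2 := covering_add_two (H := H) (k := k) u2
  have Q1 := fresh_add_stacked (H := H) (k := k + 2 * 1)
  have Q2 := fresh_add_stacked (H := H) (k := k + 2 * -1)
  have Q3 := fresh_add_stacked (H := H) (k := k + 3 * 1)
  have Q4 := fresh_add_stacked (H := H) (k := k + 3 * -1)
  have Q5 : fresh H k = 1 - stacked H k := by rw [fresh, hx]
  obtain ⟨f1, f1'⟩ := fresh_bounds (H := H) (k := k + 2 * 1)
  obtain ⟨f2, f2'⟩ := fresh_bounds (H := H) (k := k + 2 * -1)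
  obtain ⟨f3, f3'⟩ := fresh_bounds (H := H) (k := k + 3 * 1)
  obtain ⟨f4, f4'⟩ := fresh_bounds (H := H) (k := k + 3 * -1)
  have v1 := stacked_eq (H := H) (k := k)
  obtain ⟨v2, v2'⟩ := stacked_bounds (H := H) (k := k + 2 * 1)
  obtain ⟨v3, v3'⟩ := stacked_bounds (H := H) (k := k + 2 * -1)
  obtain ⟨v4, v4'⟩ := stacked_bounds (H := H) (k := k + 3 * 1)
  obtain ⟨v5, v5'⟩ := stacked_bounds (H := H) (k := k + 3 * -1)
  have w1 := covering_eq (H := H) (k := k) (e := 1)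
  have w2 := covering_eq (H := H) (k := k) (e := -1)
  obtain ⟨w3, w3'⟩ := covering_bounds (H := H) (k := k + 4 * 1) (e := -1)
  obtain ⟨w4, w4'⟩ := covering_bounds (H := H) (k := k + 4 * -1) (e := 1)
  have r1 := stacked_eq (H := pop H k) (k := k)
  have r2 := stacked_eq (H := pop H k) (k := k + 1)
  have r3 := stacked_eq (H := pop H k) (k := k + -1)
  obtain ⟨t1, t1'⟩ := covering_bounds (H := pop H k) (k := k) (e := 1)
  obtain ⟨t2, t2'⟩ := covering_bounds (H := pop H k) (k := k) (e := -1)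
  obtain ⟨t3, t3'⟩ := covering_bounds (H := pop H k) (k := k + 1) (e := 1)
  obtain ⟨t4, t4'⟩ := covering_bounds (H := pop H k) (k := k + 1) (e := -1)
  obtain ⟨t5, t5'⟩ := covering_bounds (H := pop H k) (k := k + -1) (e := 1)
  obtain ⟨t6, t6'⟩ := covering_bounds (H := pop H k) (k := k + -1) (e := -1)
  obtain ⟨t7, t7'⟩ := covering_bounds (H := pop H k) (k := k - 2 * 1) (e := 1)
  obtain ⟨t8, t8'⟩ := covering_bounds (H := pop H k) (k := k - 2 * -1) (e := -1)
  -- From here on all local quantities become independent integers; fixing a few of them makes the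
  -- products that matter linear.
  rw [show k - 2 * 1 = k + 2 * -1 by ring] at *
  rw [show k - 2 * -1 = k + 2 * 1 by ring] at *
  simp only [neg_neg] at *
  rw [A3, B3, C2, Q5]
  rw [hx] at O1 O2
  generalize stacked H k = s at *
  generalize covering 1 H k = c at *
  generalize covering (-1) H k = d at *
  generalize stacked (pop H k) k = s0 at *
  generalize stacked (pop H k) (k + 1) = s1 at *
  generalize stacked (pop H k) (k + -1) = s2 at *
  generalize covering 1 (pop H k) k = c0 at *
  generalize covering (-1) (pop H k) k = d0 at *
  generalize covering 1 (pop H k) (k + 1) = c1 at *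
  generalize covering (-1) (pop H k) (k + 1) = d1 at *
  generalize covering 1 (pop H k) (k + -1) = c2 at *
  generalize covering (-1) (pop H k) (k + -1) = d2 at *
  generalize covering 1 (pop H k) (k + 2 * -1) = g at *
  generalize covering (-1) (pop H k) (k + 2 * 1) = g' at *
  generalize fresh H (k + 2 * 1) = a at *
  generalize fresh H (k + 2 * -1) = b at *
  generalize stacked H (k + 2 * 1) = a' at *
  generalize stacked H (k + 2 * -1) = b' at *
  generalize fresh H (k + 3 * 1) = p at *
  generalize fresh H (k + 3 * -1) = q at *
  generalize stacked H (k + 3 * 1) = p' at *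
  generalize stacked H (k + 3 * -1) = q' at *
  have z1 := exposure_eq (H := H) (k := k + 3 * 1)
  have z2 := exposure_eq (H := H) (k := k + 3 * -1)
  generalize exposure H (k + 2 * 1) = X at *
  generalize exposure H (k + 2 * -1) = Y at *
  generalize exposure H (k + 3 * 1) = X' at *
  generalize exposure H (k + 3 * -1) = Y' at *
  generalize share 1 H k = S at *
  generalize share (-1) H k = S' at *
  generalize covering (-1) H (k + 4 * 1) = l at *
  generalize covering 1 H (k + 4 * -1) = l' at *
  clear A3 B3 C2 Q5 hx u1 u2
  clear hw h5 hm
  rcases v1 with rfl | rfl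
  · obtain rfl : s0 = 0 := by clear * - C1 r1 E1 t1; omega
    rcases w1 with rfl | rfl <;> rcases w2 with rfl | rfl
    · obtain rfl : s1 = 0 := by omega
      obtain rfl : s2 = 0 := by omega
      omega
    · obtain rfl : s1 = 0 := by omega
      -- Here `s2` and the exposure of `k - 3` enter products in the pair term and in the share,
      -- hence the extra split.
      rcases r3 with rfl | rfl <;> rcases z2 with rfl | rfl <;> omega
    · obtain rfl : s2 = 0 := by omega
      rcases r2 with rfl | rfl <;> rcases z1 with rfl | rfl <;> omega
    · rcases r2 with rfl | rfl <;> rcases r3 with rfl | rfl <;> omega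
  · obtain rfl : c = 0 := by omega
    obtain rfl : d = 0 := by omega
    obtain rfl : s1 = 0 := by omega
    obtain rfl : s2 = 0 := by omega
    rcases r1 with rfl | rfl <;> omega

end LocalBound

/-! ### Discharging: the total of all shares. -/

section GlobalBound

variable {m : ℕ} [NeZero m] [hm : Fact (4 ≤ m)] {H : Finset (Piece m)} {k e : ZMod m}

-- Each column distributes weight at most 2. An exposed column keeps 2; an unexposed one gives 2 to
-- its only exposed neighbour or 1 to each of two. If it has none, it serves the exposed columns at
-- distance two: a single one gets 2, while two get 1 each, shifted by one unit towards a column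
-- that covers when the other does not.
omit hm in
theorem sum_share_le : ∑ k, (share 1 H k + share (-1) H k) ≤ 2 * m := by
  have key : ∀ i : ZMod m,
      2 * exposure H i + exposure H (i - 1) * (2 - exposure H (i + 1))
      + exposure H (i + 1) * (2 - exposure H (i - 1))
      + exposure H (i - 2) * ((1 - exposure H i) * (1 - exposure H (i + 1)) *
        (2 - exposure H (i + 2) * (1 - covering 1 H (i - 2) + covering (-1) H (i + 2))))
      + exposure H (i + 2) * ((1 - exposure H i) * (1 - exposure H (i - 1)) *
        (2 - exposure H (i - 2) * (1 - covering (-1) H (i + 2) + covering 1 H (i - 2)))) ≤ 2 := by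
    intro i
    have e1 := exposure_add_succ (H := H) (k := i - 2)
    have e2 := exposure_add_succ (H := H) (k := i - 1)
    have e3 := exposure_add_succ (H := H) (k := i)
    have e4 := exposure_add_succ (H := H) (k := i + 1)
    rw [show i - 2 + 1 = i - 1 by ring] at e1
    rw [sub_add_cancel] at e2
    rw [show i + 1 + 1 = i + 2 by ring] at e4
    generalize covering 1 H (i - 2) = c
    generalize covering (-1) H (i + 2) = d
    rcases exposure_eq (H := H) (k := i) with h1 | h1 <;>
    rcases exposure_eq (H := H) (k := i - 1) with h2 | h2 <;>
    rcases exposure_eq (H := H) (k := i + 1) with h3 | h3 <;>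
    rcases exposure_eq (H := H) (k := i - 2) with h4 | h4 <;>
    rcases exposure_eq (H := H) (k := i + 2) with h5 | h5 <;>
    rw [h1, h2, h3, h4, h5] <;> omega
  have hs := Finset.sum_le_sum fun i (_ : i ∈ (Finset.univ : Finset (ZMod m))) => key i
  rw [Finset.sum_const, Finset.card_univ, ZMod.card, nsmul_eq_mul, mul_comm] at hs
  refine le_of_eq_of_le ?_ hs
  have a1 := sum_shift_sub (fun k => exposure H k * (2 - exposure H (k + 2))) 1
  have a2 := sum_shift (fun k => exposure H k * (2 - exposure H (k - 2))) 1
  have a3 := sum_shift_sub (fun k => exposure H k * ((1 - exposure H (k + 2)) *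
    (1 - exposure H (k + 3)) * (2 - exposure H (k + 4) *
      (1 - covering 1 H k + covering (-1) H (k + 4))))) 2
  have a4 := sum_shift (fun k => exposure H k * ((1 - exposure H (k - 2)) *
    (1 - exposure H (k - 3)) * (2 - exposure H (k - 4) *
      (1 - covering (-1) H k + covering 1 H (k - 4))))) 2
  simp only [show ∀ i : ZMod m, i - 1 + 2 = i + 1 by intro i; ring] at a1
  simp only [show ∀ i : ZMod m, i + 1 - 2 = i - 1 by intro i; ring] at a2
  simp only [sub_add_cancel, show ∀ i : ZMod m, i - 2 + 3 = i + 1 by intro i; ring,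
    show ∀ i : ZMod m, i - 2 + 4 = i + 2 by intro i; ring] at a3
  simp only [add_sub_cancel_right, show ∀ i : ZMod m, i + 2 - 3 = i - 1 by intro i; ring,
    show ∀ i : ZMod m, i + 2 - 4 = i - 2 by intro i; ring] at a4
  simp only [Finset.sum_add_distrib, ← Finset.mul_sum]
  rw [a1, a2, a3, a4, two_mul, ← Finset.sum_add_distrib, ← Finset.sum_add_distrib,
    ← Finset.sum_add_distrib, ← Finset.sum_add_distrib, ← Finset.sum_add_distrib,
    ← Finset.sum_add_distrib]
  refine Finset.sum_congr rfl fun k _ => ?_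
  unfold share
  simp only [mul_one, mul_neg, ← sub_eq_add_neg, neg_neg]
  ring

theorem IsHeap.potential_drift_le (hH : IsHeap H) (h5 : 5 ≤ m) :
    2008 * ∑ k, exposure H k +
      ∑ x : Step m, (potential 314 62 47 9 (dropPiece H x.1 x.2) - potential 314 62 47 9 H) ≤
    660 * m := by
  rw [hH.sum_potential, Finset.mul_sum, ← Finset.sum_add_distrib]
  refine (Finset.sum_le_sum fun k _ => siteDrift_le h5).trans ?_
  rw [Finset.sum_add_distrib, ← Finset.mul_sum, Finset.sum_const, Finset.card_univ, ZMod.card,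
    nsmul_eq_mul]
  have := sum_share_le (H := H)
  linarith

end GlobalBound

/-! ### The case m = 4, where columns at distance two meet around both sides. -/

section FourColumns

variable {H : Finset (Piece 4)} {k e : ZMod 4}

instance : Fact (4 ≤ 4) := ⟨le_rfl⟩

/-- On four columns `k + 3e` is `k - e`, whose exposure after the removal is what `covering (-e) H
k` records. -/
theorem removal_three_of_four (he : e = 1 ∨ e = -1) (hx : exposure H k = 1) :
    covering e (pop H k) (k + e) + covering (-e) H k ≤ 1 := by
  have := covering_add_two (H := pop H k) (k := k + e) he
  have h4 : (4 : ZMod 4) = 0 := rfl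
  rwa [show k + e + 2 * e = k + -e by linear_combination e * h4, exposure_pop_add hx] at this

set_option maxHeartbeats 1000000 in
theorem siteDrift_le_of_four :
    20000 * exposure H k + siteDrift 3205 542 429 45 H k ≤
      6410 + 321 * (exposure H k * (2 - exposure H (k + 2))) := by
  rcases exposure_eq (H := H) (k := k) with hx | hx
  · rw [siteDrift_of_not_exposed _ _ _ _ hx, hx]
    norm_num
  have u1 : (1 : ZMod 4) = 1 ∨ (1 : ZMod 4) = -1 := Or.inl rfl
  have u2 : (-1 : ZMod 4) = 1 ∨ (-1 : ZMod 4) = -1 := Or.inr rfl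
  rw [siteDrift_of_exposed _ _ _ _ hx, show wrap 4 = 2 from rfl, hx]
  obtain ⟨A1, A2, A3⟩ := removal_side u1 hx
  obtain ⟨B1, B2, B3⟩ := removal_side u2 hx
  obtain ⟨C1, C2⟩ := removal_center u1 hx
  obtain ⟨D1, -⟩ := removal_center u2 hx
  have E1 := removal_center_two (H := H) (k := k) u1
  have E2 := removal_center_two (H := H) (k := k) u2
  have G1 := removal_back u1 hx
  have G2 := removal_back u2 hx
  obtain ⟨-, I2, -⟩ := removal_far u1 hx
  obtain ⟨-, J2, -⟩ := removal_far u2 hx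
  obtain ⟨I1, -, -⟩ := removal_far u1 hx
  obtain ⟨J1, -, -⟩ := removal_far u2 hx
  have K1 := removal_three_of_four u1 hx
  have K2 := removal_three_of_four u2 hx
  have O1 := stacked_add_covering (H := H) (k := k) u1
  have O2 := stacked_add_covering (H := H) (k := k) u2
  have P1 := covering_add_two (H := H) (k := k) u1
  have P2 := covering_add_two (H := H) (k := k) u2
  have Q1 := fresh_add_stacked (H := H) (k := k + 2)
  have Q5 : fresh H k = 1 - stacked H k := by rw [fresh, hx]
  have Z1 : fresh H (k + 3 * 1) = 0 := by
    rw [show k + 3 * 1 = k + -1 from rfl]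
    exact fresh_of_not_exposed (exposure_unit_eq_zero u2 hx)
  have Z2 : fresh H (k + 3 * -1) = 0 := by
    rw [show k + 3 * -1 = k + 1 from rfl]
    exact fresh_of_not_exposed (exposure_unit_eq_zero u1 hx)
  have v1 := stacked_eq (H := H) (k := k)
  have w1 := covering_eq (H := H) (k := k) (e := 1)
  have w2 := covering_eq (H := H) (k := k) (e := -1)
  have r1 := stacked_eq (H := pop H k) (k := k)
  have r2 := stacked_eq (H := pop H k) (k := k + 1)
  have r3 := stacked_eq (H := pop H k) (k := k + -1)
  obtain ⟨f1, f1'⟩ := fresh_bounds (H := H) (k := k + 2)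
  obtain ⟨v2, v2'⟩ := stacked_bounds (H := H) (k := k + 2)
  obtain ⟨t1, t1'⟩ := covering_bounds (H := pop H k) (k := k) (e := 1)
  obtain ⟨t2, t2'⟩ := covering_bounds (H := pop H k) (k := k) (e := -1)
  obtain ⟨t3, t3'⟩ := covering_bounds (H := pop H k) (k := k + 1) (e := 1)
  obtain ⟨t4, t4'⟩ := covering_bounds (H := pop H k) (k := k + 1) (e := -1)
  obtain ⟨t5, t5'⟩ := covering_bounds (H := pop H k) (k := k + -1) (e := 1)
  obtain ⟨t6, t6'⟩ := covering_bounds (H := pop H k) (k := k + -1) (e := -1)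
  rw [show k - 2 * 1 = k + 2 by rw [sub_eq_add_neg]; rfl] at *
  rw [show k - 2 * -1 = k + 2 by rw [sub_eq_add_neg]; rfl] at *
  rw [show k + 2 * 1 = k + 2 from rfl] at *
  rw [show k + 2 * -1 = k + 2 from rfl] at *
  simp only [neg_neg] at *
  rw [A3, B3, C2, Q5, Z1, Z2]
  rw [hx] at O1 O2
  generalize stacked H k = s at *
  generalize covering 1 H k = c at *
  generalize covering (-1) H k = d at *
  generalize stacked (pop H k) k = s0 at *
  generalize stacked (pop H k) (k + 1) = s1 at *
  generalize stacked (pop H k) (k + -1) = s2 at *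
  generalize covering 1 (pop H k) k = c0 at *
  generalize covering (-1) (pop H k) k = d0 at *
  generalize covering 1 (pop H k) (k + 1) = c1 at *
  generalize covering (-1) (pop H k) (k + 1) = d1 at *
  generalize covering 1 (pop H k) (k + -1) = c2 at *
  generalize covering (-1) (pop H k) (k + -1) = d2 at *
  generalize covering 1 (pop H k) (k + 2) = g at *
  generalize covering (-1) (pop H k) (k + 2) = g' at *
  generalize fresh H (k + 2) = a at *
  generalize stacked H (k + 2) = a' at *
  generalize exposure H (k + 2) = X at *
  clear A3 B3 C2 Q5 hx u1 u2 Z1 Z2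
  rcases v1 with rfl | rfl
  · obtain rfl : s0 = 0 := by clear * - C1 r1 E1 t1; omega
    rcases w1 with rfl | rfl <;> rcases w2 with rfl | rfl <;>
    rcases r2 with rfl | rfl <;> rcases r3 with rfl | rfl <;> omega
  · obtain rfl : c = 0 := by omega
    obtain rfl : d = 0 := by omega
    obtain rfl : s1 = 0 := by omega
    obtain rfl : s2 = 0 := by omega
    rcases r1 with rfl | rfl <;> omega

/-- At most two columns are exposed, and two must be opposite: the sum is 0, 2 or 1 + 1. -/
theorem sum_share_le_of_four : ∑ k, exposure H k * (2 - exposure H (k + 2)) ≤ 2 := by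
  have h : ∑ k, exposure H k * (2 - exposure H (k + 2)) =
      exposure H 0 * (2 - exposure H 2) + exposure H 1 * (2 - exposure H 3)
      + exposure H 2 * (2 - exposure H 0) + exposure H 3 * (2 - exposure H 1) :=
    Fin.sum_univ_four _
  rw [h]
  have e0 : exposure H 0 + exposure H 1 ≤ 1 := exposure_add_succ
  have e1 : exposure H 1 + exposure H 2 ≤ 1 := exposure_add_succ
  have e2 : exposure H 2 + exposure H 3 ≤ 1 := exposure_add_succ
  have e3 : exposure H 3 + exposure H 0 ≤ 1 := exposure_add_succ
  rcases exposure_eq (H := H) (k := 0) with h0 | h0 <;>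
  rcases exposure_eq (H := H) (k := 1) with h1 | h1 <;>
  rcases exposure_eq (H := H) (k := 2) with h2 | h2 <;>
  rcases exposure_eq (H := H) (k := 3) with h3 | h3 <;>
  rw [h0, h1, h2, h3] <;> omega

theorem IsHeap.potential_drift_le_of_four (hH : IsHeap H) :
    20000 * ∑ k, exposure H k +
      ∑ x : Step 4,
        (potential 3205 542 429 45 (dropPiece H x.1 x.2) - potential 3205 542 429 45 H) ≤
    26282 := by
  rw [hH.sum_potential, Finset.mul_sum, ← Finset.sum_add_distrib]
  refine (Finset.sum_le_sum fun k _ => siteDrift_le_of_four).trans ?_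
  rw [Finset.sum_add_distrib, ← Finset.mul_sum, Finset.sum_const, Finset.card_univ, ZMod.card,
    nsmul_eq_mul]
  have := sum_share_le_of_four (H := H)
  push_cast
  linarith

end FourColumns

/-! ### Transition operators of walks with uniform steps. -/

section Transition

variable {m : ℕ} {S : Type*}

/-- The transition operator of the walk with uniform steps that moves by `act`. -/
noncomputable def transition (act : S → Step m → S) [NeZero m] (f : S → ℝ) (a : S) : ℝ :=
  (∑ x : Step m, f (act a x)) / (2 * m)

variable [NeZero m] {act : S → Step m → S} {f g : S → ℝ}

theorem card_step : (Fintype.card (Step m) : ℝ) = 2 * m := by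
  rw [Fintype.card_prod, ZMod.card, Fintype.card_units_int]; push_cast; ring

theorem two_mul_pos_cast : (0 : ℝ) < 2 * m := by
  have := NeZero.pos m
  positivity

theorem transition_const (c : ℝ) : transition act (fun _ => c) = fun _ : S => c := by
  funext a
  rw [transition, Finset.sum_const, Finset.card_univ, nsmul_eq_mul, card_step]
  exact mul_div_cancel_left₀ _ two_mul_pos_cast.ne'

theorem transition_sub : transition act (f - g) = transition act f - transition act g := by
  funext a
  simp only [transition, Pi.sub_apply, Finset.sum_sub_distrib, sub_div]

theorem transition_smul (c : ℝ) : transition act (c • f) = c • transition act f := by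
  funext a
  simp only [transition, Pi.smul_apply, smul_eq_mul, ← Finset.mul_sum, mul_div_assoc]

theorem iterate_transition_const (c : ℝ) (n : ℕ) :
    (transition act)^[n] (fun _ => c) = fun _ : S => c := by
  induction n with
  | zero => rfl
  | succ n ih => rw [Function.iterate_succ_apply, transition_const, ih]

theorem iterate_transition_sub (n : ℕ) : (transition act)^[n] (f - g) =
    (transition act)^[n] f - (transition act)^[n] g := by
  induction n generalizing f g with
  | zero => rfl
  | succ n ih => simp only [Function.iterate_succ_apply, transition_sub, ih]

theorem iterate_transition_smul (c : ℝ) (n : ℕ) : (transition act)^[n] (c • f) =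
    c • (transition act)^[n] f := by
  induction n generalizing f with
  | zero => rfl
  | succ n ih => simp only [Function.iterate_succ_apply, transition_smul, ih]

/-- The transition operator is monotone on invariant sets. -/
theorem iterate_transition_mono {P : S → Prop} (hP : ∀ a x, P a → P (act a x))
    (h : ∀ a, P a → f a ≤ g a) (n : ℕ) :
    ∀ a, P a → (transition act)^[n] f a ≤ (transition act)^[n] g a := by
  induction n generalizing f g with
  | zero => exact h
  | succ n ih =>
    simp only [Function.iterate_succ_apply]
    refine ih fun a ha => ?_
    have := two_mul_pos_cast (m := m)
    unfold transition
    gcongr with x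
    exact h _ (hP a x ha)

/-- Semiconjugate walks have corresponding transition operators. -/
theorem iterate_transition_comp {T : Type*} {act' : T → Step m → T} (φ : S → T)
    (hφ : ∀ a x, φ (act a x) = act' (φ a) x) (f : T → ℝ) (n : ℕ) (a : S) :
    (transition act)^[n] (fun b => f (φ b)) a = (transition act')^[n] f (φ a) := by
  induction n generalizing f with
  | zero => rfl
  | succ n ih =>
    rw [Function.iterate_succ_apply, Function.iterate_succ_apply, ← ih]
    have : (transition act fun b => f (φ b)) = fun b => transition act' f (φ b) := by
      funext b
      simp only [transition, hφ]
    rw [this]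

end Transition

/-! ### Expectations as iterates of the transition operator. -/

section Expectation

variable {m : ℕ} [NeZero m]

instance : MeasurableSingletonClass ℤˣ :=
  ⟨fun u => ⟨{(u : ℤ)}, trivial, by ext v; simp [Units.ext_iff]⟩⟩

instance : IsProbabilityMeasure (stepLaw m) := by unfold stepLaw; infer_instance

omit [NeZero m] in
theorem heapProcess_congr {ξ η : ℕ → Step m} {n : ℕ} (h : ∀ i < n, ξ i = η i) :
    heapProcess ξ n = heapProcess η n := by
  induction n with
  | zero => rfl
  | succ n ih =>
    rw [heapProcess, heapProcess, ih fun i hi => h i (by omega), h n (by omega)]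

/-- The heap determined by the steps before time `n`. -/
def heapOfSteps (n : ℕ) (r : Finset.range n → Step m) : Finset (Piece m) :=
  heapProcess (fun i => if h : i ∈ Finset.range n then r ⟨i, h⟩ else default) n

omit [NeZero m] in
theorem heapOfSteps_restrict (n : ℕ) (ξ : ℕ → Step m) :
    heapOfSteps n (fun i => ξ i) = heapProcess ξ n := by
  refine heapProcess_congr fun i hi => ?_
  simp [hi]

/-- The heap at time `n` factors through finitely many steps with finitely many values, so every
function of it is measurable and bounded. -/
theorem measurable_comp_heapProcess (f : Finset (Piece m) → ℝ) (n : ℕ) :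
    Measurable fun ξ : ℕ → Step m => f (heapProcess ξ n) := by
  have : (fun ξ : ℕ → Step m => f (heapProcess ξ n)) =
      (fun r => f (heapOfSteps n r)) ∘ fun (ξ : ℕ → Step m) (i : Finset.range n) => ξ i := by
    funext ξ; simp [heapOfSteps_restrict]
  rw [this]
  exact (measurable_of_finite _).comp (by fun_prop)

theorem integrable_comp_heapProcess (f : Finset (Piece m) → ℝ) (n : ℕ) :
    Integrable (fun ξ : ℕ → Step m => f (heapProcess ξ n)) (stepLaw m) := by
  obtain ⟨C, hC⟩ := (Set.finite_range fun r => ‖f (heapOfSteps (m := m) n r)‖).bddAbove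
  refine Integrable.of_bound (measurable_comp_heapProcess f n).aestronglyMeasurable C ?_
  refine Eventually.of_forall fun ξ => ?_
  rw [← heapOfSteps_restrict]
  exact hC ⟨_, rfl⟩

theorem integral_indicator_mul (f : Finset (Piece m) → ℝ) (n : ℕ) (x : Step m) :
    ∫ ξ, f (heapProcess ξ n) * Set.indicator {x} 1 (ξ n) ∂(stepLaw m) =
      (∫ ξ, f (heapProcess ξ n) ∂(stepLaw m)) / (2 * m) := by
  have hi : ProbabilityTheory.iIndepFun (fun i (ξ : ℕ → Step m) => ξ i) (stepLaw m) :=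
    ProbabilityTheory.iIndepFun_infinitePi (X := fun _ x => x) fun _ => measurable_id
  have h2 := hi.indepFun_finset (Finset.range n) {n} (by simp) (fun i => by fun_prop)
  have h3 := h2.comp (φ := fun r => f (heapOfSteps n r))
    (ψ := fun r => Set.indicator {x} (1 : Step m → ℝ) (r ⟨n, by simp⟩))
    (measurable_of_finite _) (measurable_of_finite _)
  have h4 := h3.integral_fun_mul_eq_mul_integral
    ((measurable_of_finite _).comp (by fun_prop)).aestronglyMeasurable
    ((measurable_of_finite _).comp (by fun_prop)).aestronglyMeasurable
  simp only [Function.comp_apply, heapOfSteps_restrict] at h4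
  rw [h4, div_eq_mul_inv]
  congr 1
  have h5 : ∫ ξ : ℕ → Step m, Set.indicator {x} (1 : Step m → ℝ) (ξ n) ∂(stepLaw m) =
      ∫ y, Set.indicator {x} (1 : Step m → ℝ) y ∂((stepLaw m).map fun ξ => ξ n) :=
    (integral_map (measurable_pi_apply n).aemeasurable
      (measurable_of_finite _).aestronglyMeasurable).symm
  rw [h5, stepLaw, Measure.infinitePi_map_eval, integral_indicator_one (measurableSet_singleton x),
    measureReal_def, PMF.toMeasure_apply_singleton _ _ (measurableSet_singleton x),
    PMF.uniformOfFintype_apply, ENNReal.toReal_inv, ENNReal.toReal_natCast, card_step]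

theorem integral_heapProcess (f : Finset (Piece m) → ℝ) (n : ℕ) :
    ∫ ξ, f (heapProcess ξ n) ∂(stepLaw m) =
      (transition fun H (x : Step m) => dropPiece H x.1 x.2)^[n] f ∅ := by
  induction n generalizing f with
  | zero => simp [heapProcess]
  | succ n ih =>
    rw [Function.iterate_succ_apply, ← ih]
    -- Splitting by the value of the last step allows its independence from the heap before it to be
    -- used term by term.
    have h1 : ∀ ξ : ℕ → Step m, f (heapProcess ξ (n + 1)) =
        ∑ x : Step m, f (dropPiece (heapProcess ξ n) x.1 x.2) *
          Set.indicator {x} 1 (ξ n) := by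
      intro ξ
      rw [Finset.sum_eq_single (ξ n)]
      · simp [heapProcess]
      · intro x _ hx
        simp [hx.symm]
      · simp
    simp only [h1, transition]
    rw [integral_finsetSum]
    · rw [Finset.sum_congr rfl fun x _ =>
        integral_indicator_mul (fun H => f (dropPiece H x.1 x.2)) n x]
      rw [← Finset.sum_div, integral_div, integral_finsetSum]
      exact fun x _ => integrable_comp_heapProcess (fun H => f (dropPiece H x.1 x.2)) n
    · intro x _
      have := integrable_comp_heapProcess (fun H => f (dropPiece H x.1 x.2)) n
      have hm : Measurable fun ξ : ℕ → Step m => Set.indicator {x} (1 : Step m → ℝ) (ξ n) :=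
        (measurable_of_finite (Set.indicator {x} (1 : Step m → ℝ))).comp (measurable_pi_apply n)
      refine this.mul_bdd (c := 1) hm.aestronglyMeasurable (Eventually.of_forall fun ξ => ?_)
      by_cases h : ξ n = x <;> simp [Set.indicator, h]

end Expectation

/-! ### Contraction of 2^(-norm) in free groups. -/

section FreeGroupNorm

variable {α : Type*} [DecidableEq α]

/-- In a free group, at most one letter shortens a given element under left multiplication. -/
theorem FreeGroup.exists_norm_mk_mul (u : FreeGroup α) :
    ∃ y : Option (α × Bool), ∀ x : α × Bool, some x ≠ y →
      (FreeGroup.mk [x] * u).norm = u.norm + 1 := by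
  refine ⟨u.toWord.head?.map fun p => (p.1, !p.2), fun x hx => ?_⟩
  have h1 : (FreeGroup.mk [x] * u).toWord = FreeGroup.reduce (x :: u.toWord) := by
    conv_lhs => rw [← FreeGroup.mk_toWord (x := u), FreeGroup.mul_mk, FreeGroup.toWord_mk]
    rfl
  rw [FreeGroup.norm, h1, FreeGroup.reduce.cons, FreeGroup.reduce_toWord, FreeGroup.norm]
  cases h2 : u.toWord with
  | nil => rfl
  | cons p L =>
    rw [h2] at hx
    have : ¬ (x.1 = p.1 ∧ x.2 = !p.2) := fun h => hx (by simp [Prod.ext_iff, h.1, h.2])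
    simp [this]

theorem FreeGroup.norm_le_norm_mk_mul (u : FreeGroup α) (x : α × Bool) :
    u.norm ≤ (FreeGroup.mk [x] * u).norm + 1 := by
  have h := FreeGroup.norm_mul_le (FreeGroup.mk [x])⁻¹ (FreeGroup.mk [x] * u)
  rw [inv_mul_cancel_left, FreeGroup.norm_inv_eq] at h
  have h2 : (FreeGroup.mk [x]).norm ≤ 1 := by simpa using FreeGroup.norm_mk_le (L₁ := [x])
  omega

/-- The function `2 ^ (-norm)` contracts under a uniform step to one of four neighbours. -/
theorem FreeGroup.sum_half_pow_norm_le (v : FreeGroup α) (s : Finset (α × Bool)) (hs : s.card = 4) :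
    ∑ x ∈ s, (1 / 2 : ℝ) ^ (v * FreeGroup.mk [x]).norm ≤ 7 / 2 * (1 / 2) ^ v.norm := by
  obtain ⟨y, hy⟩ := FreeGroup.exists_norm_mk_mul v⁻¹
  have hinv : ∀ x : α × Bool, (v * FreeGroup.mk [x]).norm =
      (FreeGroup.mk [(x.1, !x.2)] * v⁻¹).norm := by
    intro x
    rw [← FreeGroup.norm_inv_eq, mul_inv_rev, FreeGroup.inv_mk]
    rfl
  have hp : (0 : ℝ) < (1 / 2) ^ v.norm := by positivity
  -- A lengthening letter contributes half the old value, the exceptional one at most twice it: in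
  -- total at most 4 · 1/2 + 3/2 = 7/2.
  have hle : ∀ x ∈ s, (1 / 2 : ℝ) ^ (v * FreeGroup.mk [x]).norm ≤
      1 / 2 * (1 / 2) ^ v.norm +
        if some (x.1, !x.2) = y then 3 / 2 * (1 / 2) ^ v.norm else 0 := by
    intro x _
    rw [hinv]
    split_ifs with h
    · have h1 := FreeGroup.norm_le_norm_mk_mul v⁻¹ (x.1, !x.2)
      rw [FreeGroup.norm_inv_eq] at h1
      have h2 : (1 / 2 : ℝ) ^ ((FreeGroup.mk [(x.1, !x.2)] * v⁻¹).norm + 1) ≤ (1 / 2) ^ v.norm :=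
        pow_le_pow_of_le_one (by norm_num) (by norm_num) h1
      rw [pow_succ] at h2
      linarith
    · rw [hy _ h, FreeGroup.norm_inv_eq, pow_succ]
      linarith
  refine (Finset.sum_le_sum hle).trans ?_
  rw [Finset.sum_add_distrib, Finset.sum_const, hs, ← Finset.sum_filter, Finset.sum_const]
  have hc : (s.filter fun x => some (x.1, !x.2) = y).card ≤ 1 := by
    rw [Finset.card_le_one]
    intro a ha b hb
    rw [Finset.mem_filter] at ha hb
    have := ha.2.trans hb.2.symm
    simp only [Option.some.injEq, Prod.mk.injEq, Bool.not_inj_iff] at this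
    exact Prod.ext this.1 this.2
  have hc' : ((s.filter fun x => some (x.1, !x.2) = y).card : ℝ) ≤ 1 := by exact_mod_cast hc
  simp only [nsmul_eq_mul]
  push_cast
  nlinarith

end FreeGroupNorm

/-! ### Projection to a free group, and convergence of the ground probabilities. -/

section Transience

variable {m : ℕ} {H : Finset (Piece m)} {j k : ZMod m} {s t : ℤˣ}

/-- The homomorphism to a free group of rank two that kills all generators but `g_j`, `g_{j+1}`. -/
def project (j : ZMod m) : LocallyFreeGroup m →* FreeGroup (ZMod m) :=
  PresentedGroup.toGroup
    (f := fun i => if i = j ∨ i = j + 1 then FreeGroup.of i else 1) (by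
      rintro r ⟨a, b, h1, h2, rfl⟩
      simp only [map_mul, map_inv, FreeGroup.lift_apply_of]
      rw [mul_inv_eq_one, mul_inv_eq_iff_eq_mul]
      by_cases ha : a = j ∨ a = j + 1
      · by_cases hb : b = j ∨ b = j + 1
        · have : a = b := by
            rcases ha with rfl | rfl <;> rcases hb with rfl | rfl
            · rfl
            · exact absurd (add_sub_cancel_right _ _).symm h2
            · exact absurd rfl h1
            · rfl
          rw [this]
        · simp [hb]
      · simp [ha])

theorem project_letter (h : k = j ∨ k = j + 1) :
    project j (letter k s) = FreeGroup.mk [(k, decide (s = 1))] := by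
  have h0 : project j (PresentedGroup.of k) = FreeGroup.of k := by
    rw [project, PresentedGroup.toGroup.of, if_pos h]
  rcases Int.units_eq_one_or s with h | h
  · rw [h, letter_one, h0]; rfl
  · rw [h, letter_neg, letter_one, map_inv, h0]; rfl

theorem project_letter_of_ne (h : ¬ (k = j ∨ k = j + 1)) : project j (letter k s) = 1 := by
  have h0 : project j (PresentedGroup.of k) = 1 := by
    rw [project, PresentedGroup.toGroup.of, if_neg h]
  rw [letter, map_zpow, h0, one_zpow]

theorem Reduced.project_eq_one {w : LocallyFreeGroup m} (h : Reduced H w)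
    (he : ∀ p ∈ H, ¬ CloseCols p.col j) : project j w = 1 := by
  induction h with
  | empty => exact map_one _
  | add k s _ _ ih =>
    rw [map_mul, ih fun p hp => he p (Finset.mem_insert_of_mem hp), one_mul]
    refine project_letter_of_ne fun hk => ?_
    refine he _ (Finset.mem_insert_self _ _) ?_
    rcases hk with h | h
    · exact Or.inr (Or.inl h)
    · exact Or.inr (Or.inr h)

/-- A function on the group that decays along the walk. -/
noncomputable def decay (j : ZMod m) (w : LocallyFreeGroup m) : ℝ :=
  (1 / 2) ^ (project j w).norm

variable [NeZero m] [hm : Fact (4 ≤ m)]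

/-- The transition operator of the walk on the group. -/
noncomputable abbrev groupTransition :
    (LocallyFreeGroup m → ℝ) → LocallyFreeGroup m → ℝ :=
  transition fun w (x : Step m) => w * letter x.1 x.2

/-- Four of the 2m steps survive the projection and contribute at most 7/2 in place of 4; the other
2m - 4 change nothing. Thus the factor is (2m - 1/2)/(2m). -/
theorem transition_decay_le (j : ZMod m) (w : LocallyFreeGroup m) :
    groupTransition (decay j) w ≤ (1 - 1 / (4 * m)) * decay j w := by
  have hpos := two_mul_pos_cast (m := m)
  set A : Finset (ZMod m) := {j, j + 1} with hA
  have hAc : A.card = 2 := Finset.card_pair (col_succ_ne j).symm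
  have h1 : ∑ x : Step m, decay j (w * letter x.1 x.2) ≤ (2 * m - 1 / 2) * decay j w := by
    rw [← Finset.sum_filter_add_sum_filter_not Finset.univ (fun x : Step m => x.1 ∈ A)]
    have h2 : ∑ x ∈ Finset.univ.filter (fun x : Step m => x.1 ∈ A),
        decay j (w * letter x.1 x.2) ≤ 7 / 2 * decay j w := by
      have hinj : Function.Injective fun x : Step m => (x.1, decide (x.2 = 1)) := by
        rintro ⟨a, s⟩ ⟨b, t⟩ h
        simp only [Prod.mk.injEq] at h
        rcases Int.units_eq_one_or s with hs | hs <;> rcases Int.units_eq_one_or t with ht | ht <;>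
          simp_all
      have h3 := FreeGroup.sum_half_pow_norm_le (project j w)
        ((Finset.univ.filter (fun x : Step m => x.1 ∈ A)).map ⟨_, hinj⟩) (by
          rw [Finset.card_map]
          have : Finset.univ.filter (fun x : Step m => x.1 ∈ A) = A ×ˢ Finset.univ := by
            ext x; simpa using fun _ => Int.units_eq_one_or x.2
          rw [this, Finset.card_product, hAc]; rfl)
      rw [Finset.sum_map] at h3
      refine le_of_eq_of_le (Finset.sum_congr rfl fun x hx => ?_) h3
      have hx' : x.1 = j ∨ x.1 = j + 1 := by simpa [hA] using hx
      rw [decay, map_mul, project_letter hx']; rfl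
    have h4 : ∑ x ∈ Finset.univ.filter (fun x : Step m => ¬ x.1 ∈ A),
        decay j (w * letter x.1 x.2) = (2 * m - 4) * decay j w := by
      rw [Finset.sum_congr rfl (g := fun _ => decay j w), Finset.sum_const, nsmul_eq_mul]
      · congr 1
        have : Finset.univ.filter (fun x : Step m => ¬ x.1 ∈ A) = Aᶜ ×ˢ Finset.univ := by
          ext x; simpa using fun _ => Int.units_eq_one_or x.2
        rw [this, Finset.card_product, Finset.card_compl, hAc, ZMod.card, Finset.card_univ,
          Fintype.card_units_int]
        have := hm.out
        push_cast [Nat.cast_sub (show 2 ≤ m by omega)]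
        ring
      · intro x hx
        have hx' : ¬ (x.1 = j ∨ x.1 = j + 1) := by simpa [hA] using hx
        rw [decay, map_mul, project_letter_of_ne hx', mul_one, decay]
    rw [h4]
    linarith
  rw [groupTransition, transition, div_le_iff₀ hpos]
  refine h1.trans (le_of_eq ?_)
  have : (m : ℝ) ≠ 0 := by linarith
  field_simp
  ring

theorem iterate_transition_decay_le (j : ZMod m) (n : ℕ) :
    (groupTransition)^[n] (decay j) 1 ≤ (1 - 1 / (4 * m)) ^ n := by
  have hr : (0 : ℝ) ≤ 1 - 1 / (4 * m) := by
    have : (4 : ℝ) ≤ m := by exact_mod_cast hm.out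
    rw [sub_nonneg, div_le_one (by linarith)]; linarith
  induction n with
  | zero => simp [decay]
  | succ n ih =>
    rw [Function.iterate_succ_apply]
    have h := iterate_transition_mono (act := fun w (x : Step m) => w * letter x.1 x.2)
      (P := fun _ => True) (fun _ _ _ => trivial)
      (f := groupTransition (decay j)) (g := (1 - 1 / (4 * (m : ℝ))) • decay j)
      (fun w _ => transition_decay_le j w) n 1 trivial
    rw [iterate_transition_smul] at h
    refine h.trans ?_
    rw [Pi.smul_apply, smul_eq_mul, pow_succ, mul_comm]
    exact mul_le_mul_of_nonneg_right ih hr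

/-- Indicator of the elements whose heap has the piece `(j, t)` on the ground. -/
noncomputable def ground (j : ZMod m) (t : ℤˣ) (w : LocallyFreeGroup m) : ℝ :=
  if (⟨1, j, t⟩ : Piece m) ∈ toHeap w then 1 else 0

-- A ground piece of column `j` appears or disappears only if, before or after the step
-- respectively, no piece is in the columns `j - 1`, `j`, `j + 1`. Then the projection is trivial at
-- that moment and one letter away at the other.
omit [NeZero m] in
theorem norm_project_le_of_ground_ne {w : LocallyFreeGroup m}
    (h : ground j t (w * letter k s) ≠ ground j t w) : (project j w).norm ≤ 1 := by
  have hw := reduced_toHeap w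
  have hw' := reduced_toHeap (w * letter k s)
  rw [ground, ground, toHeap_mul_letter] at h
  rw [toHeap_mul_letter] at hw'
  by_cases hc : Cancels (toHeap w) k s
  · rw [(isHeap_toHeap w).dropPiece_of_cancels hc] at h hw'
    have h1 : (⟨1, j, t⟩ : Piece m) ∈ toHeap w ∧ (⟨1, j, t⟩ : Piece m) ∉ pop (toHeap w) k := by
      by_cases hp : (⟨1, j, t⟩ : Piece m) ∈ pop (toHeap w) k
      · simp [hp, pop_subset hp] at h
      · refine ⟨by_contra fun hp' => h ?_, hp⟩
        simp [hp, hp']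
    have h2 : j = k ∧ 1 = colHeight (toHeap w) k := by
      by_contra h2
      exact h1.2 (Finset.mem_filter.2 ⟨h1.1, h2⟩)
    obtain ⟨rfl, h2⟩ := h2
    have h3 : project j (w * letter j s) = 1 := by
      refine hw'.project_eq_one fun p hp hcl => ?_
      have h4 := hw'.isHeap.one_le_height p hp
      by_cases hj : p.col = j
      · have h5 := height_le_colHeight_of_col hp hj
        have h6 := colHeight_pop_self_lt hc.1.pos
        omega
      · have := hc.1.height_lt (pop_subset hp) hcl hj
        omega
    rw [map_mul, project_letter (Or.inl rfl)] at h3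
    rw [eq_inv_of_mul_eq_one_left h3, FreeGroup.norm_inv_eq]
    simpa using FreeGroup.norm_mk_le (L₁ := [(j, decide (s = 1))])
  · rw [dropPiece_of_not_cancels hc] at h
    have h1 : (⟨1, j, t⟩ : Piece m) = ⟨restHeight (toHeap w) k, k, s⟩ := by
      by_contra hne
      simp [push, hne] at h
    simp only [Piece.mk.injEq] at h1
    obtain ⟨h1, rfl, rfl⟩ := h1
    rw [hw.project_eq_one (empty_of_restHeight_eq_one hw.isHeap h1.symm)]
    simp

omit [NeZero m] in
theorem abs_ground_sub_le (w : LocallyFreeGroup m) :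
    |ground j t (w * letter k s) - ground j t w| ≤ 2 * decay j w := by
  by_cases h : ground j t (w * letter k s) = ground j t w
  · rw [h, sub_self, abs_zero, decay]; positivity
  · have h1 := norm_project_le_of_ground_ne h
    have h2 : (1 / 2 : ℝ) ^ 1 ≤ decay j w :=
      pow_le_pow_of_le_one (by norm_num) (by norm_num) h1
    have h3 : |ground j t (w * letter k s) - ground j t w| ≤ 1 := by
      unfold ground; split_ifs <;> norm_num
    linarith

/-- The probability to find a given piece on the ground converges. -/
theorem exists_tendsto_ground (j : ZMod m) (t : ℤˣ) :
    ∃ b, Tendsto (fun n : ℕ => (groupTransition)^[n] (ground j t) 1) atTop (𝓝 b) := by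
  refine cauchySeq_tendsto_of_complete
    (cauchySeq_of_le_geometric (1 - 1 / (4 * (m : ℝ))) 2 ?_ fun n => ?_)
  · have : (0 : ℝ) < m := by have := two_mul_pos_cast (m := m); linarith
    have : 0 < 1 / (4 * (m : ℝ)) := by positivity
    linarith
  · have hstep : ∀ w, |groupTransition (ground j t) w - ground j t w| ≤ 2 * decay j w := by
      intro w
      have hpos := two_mul_pos_cast (m := m)
      have h1 : groupTransition (ground j t) w - ground j t w =
          (∑ x : Step m, (ground j t (w * letter x.1 x.2) - ground j t w)) / (2 * m) := by
        rw [Finset.sum_sub_distrib, Finset.sum_const, Finset.card_univ, nsmul_eq_mul, card_step,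
          sub_div, mul_div_cancel_left₀ _ hpos.ne']
        rfl
      rw [h1, abs_div, abs_of_pos hpos, div_le_iff₀ hpos]
      refine (Finset.abs_sum_le_sum_abs _ _).trans ?_
      refine (Finset.sum_le_sum fun x _ => abs_ground_sub_le w).trans (le_of_eq ?_)
      rw [Finset.sum_const, Finset.card_univ, nsmul_eq_mul, card_step]
      ring
    have hd := iterate_transition_decay_le (m := m) j n
    -- Used with `c = 1` and `c = -1` to bound the absolute value through monotonicity alone.
    have key : ∀ c : ℝ, (∀ w, c * (groupTransition (ground j t) w - ground j t w) ≤ 2 * decay j w) →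
        c * ((groupTransition)^[n] (groupTransition (ground j t)) 1
          - (groupTransition)^[n] (ground j t) 1) ≤ 2 * (1 - 1 / (4 * (m : ℝ))) ^ n := by
      intro c hc
      have h := iterate_transition_mono (act := fun w (x : Step m) => w * letter x.1 x.2)
        (P := fun _ => True) (fun _ _ _ => trivial)
        (f := c • (groupTransition (ground j t) - ground j t)) (g := (2 : ℝ) • decay j)
        (fun w _ => hc w) n 1 trivial
      rw [iterate_transition_smul, iterate_transition_smul, iterate_transition_sub] at h
      simp only [Pi.smul_apply, Pi.sub_apply, smul_eq_mul] at h
      linarith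
    rw [dist_comm, Real.dist_eq, Function.iterate_succ_apply, abs_le]
    have k1 := key 1 fun w => by have := (abs_le.1 (hstep w)).2; linarith
    have k2 := key (-1) fun w => by have := (abs_le.1 (hstep w)).1; linarith
    constructor <;> linarith

end Transience

/-- A convergent sequence is bounded in the limit by its drift bound against a nonnegative
potential. -/
theorem le_of_tendsto_of_potential {a F : ℕ → ℝ} {t N c : ℝ} (hN : 0 < N)
    (ha : Tendsto a atTop (𝓝 t)) (hF : ∀ n, 0 ≤ F n)
    (h : ∀ n, N * a n + (F (n + 1) - F n) ≤ c) : t ≤ c / N := by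
  have h1 : ∀ n : ℕ, N * ∑ i ∈ Finset.range n, a i + (F n - F 0) ≤ n * c := by
    intro n
    induction n with
    | zero => simp
    | succ n ih =>
      rw [Finset.sum_range_succ]
      push_cast
      linarith [h n]
  have h2 : Tendsto (fun n : ℕ => c + F 0 * (n : ℝ)⁻¹) atTop (𝓝 (c + F 0 * 0)) :=
    (tendsto_inv_atTop_nhds_zero_nat.const_mul _).const_add _
  have h3 := le_of_tendsto_of_tendsto (ha.cesaro.const_mul N) h2 (by
    filter_upwards [eventually_gt_atTop 0] with n hn
    have hn' : (0 : ℝ) < n := by exact_mod_cast hn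
    have h4 : N * ∑ i ∈ Finset.range n, a i ≤ n * c + F 0 := by linarith [h1 n, hF n]
    calc N * ((n : ℝ)⁻¹ * ∑ i ∈ Finset.range n, a i)
        = (N * ∑ i ∈ Finset.range n, a i) * (n : ℝ)⁻¹ := by ring
      _ ≤ (n * c + F 0) * (n : ℝ)⁻¹ := by gcongr
      _ = c + F 0 * (n : ℝ)⁻¹ := by field_simp)
  rw [le_div_iff₀ hN]
  linarith

/-! ### Existence of the limits and the final numerical bound. -/

section Limits

variable {m : ℕ} [NeZero m]

/-- The transition operator of the heap process. -/
noncomputable abbrev heapTransition : (Finset (Piece m) → ℝ) → Finset (Piece m) → ℝ :=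
  transition fun H (x : Step m) => dropPiece H x.1 x.2

theorem transition_sub_self {S : Type*} {act : S → Step m → S} (f : S → ℝ) (a : S) :
    transition act f a - f a = (∑ x : Step m, (f (act a x) - f a)) / (2 * m) := by
  rw [Finset.sum_sub_distrib, Finset.sum_const, Finset.card_univ, nsmul_eq_mul, card_step,
    sub_div, mul_div_cancel_left₀ _ two_mul_pos_cast.ne', transition]

theorem expectedRoof_eq (n : ℕ) :
    expectedRoof m n = (heapTransition)^[n] (fun H : Finset (Piece m) => ((roof H).card : ℝ)) ∅ :=
  integral_heapProcess (fun H => ((roof H).card : ℝ)) n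

theorem expectedSize_eq (n : ℕ) :
    expectedSize m n = (heapTransition)^[n] (fun H : Finset (Piece m) => (H.card : ℝ)) ∅ :=
  integral_heapProcess (fun H => (H.card : ℝ)) n

theorem IsHeap.sum_exposure {H : Finset (Piece m)} (hH : IsHeap H) :
    ∑ k, exposure H k = (roof H).card := by
  rw [hH.card_roof]
  simp [exposure]

theorem potential_nonneg {α β γ δ : ℤ} (hα : 0 ≤ α) (hβ : 0 ≤ β) (hγ : 0 ≤ γ) (hδ : 0 ≤ δ)
    (H : Finset (Piece m)) : 0 ≤ potential α β γ δ H := by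
  have h1 : ∀ k, 0 ≤ exposure H k := fun k => by
    rcases exposure_eq (H := H) (k := k) with h | h <;> omega
  have h2 : ∀ k, 0 ≤ fresh H k * fresh H (k + 2) := fun k =>
    mul_nonneg fresh_bounds.1 fresh_bounds.1
  have h3 : ∀ e, 0 ≤ ∑ k, covering e H k := fun e =>
    Finset.sum_nonneg fun k _ => covering_bounds.1
  have h4 : 0 ≤ ∑ k, stacked H k := Finset.sum_nonneg fun k _ => stacked_bounds.1
  have h5 := Finset.sum_nonneg fun k (_ : k ∈ Finset.univ) => h1 k
  have h6 := Finset.sum_nonneg fun k (_ : k ∈ Finset.univ) => h2 k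
  have h7 := add_nonneg (h3 1) (h3 (-1))
  unfold potential
  positivity

variable [hm : Fact (4 ≤ m)]

theorem iterate_heapTransition_mono {f g : Finset (Piece m) → ℝ}
    (h : ∀ H, IsHeap H → f H ≤ g H) (n : ℕ) :
    (heapTransition)^[n] f ∅ ≤ (heapTransition)^[n] g ∅ :=
  iterate_transition_mono (fun _ x hH => hH.drop x.1 x.2) h n ∅ isHeap_empty

theorem IsHeap.transition_card {H : Finset (Piece m)} (hH : IsHeap H) :
    heapTransition (fun H => (H.card : ℝ)) H - H.card = 1 - 1 / m * ((roof H).card : ℝ) := by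
  have hpos := two_mul_pos_cast (m := m)
  have hpos' : (0 : ℝ) < m := by linarith
  rw [transition_sub_self]
  have h1 : ∑ x : Step m, (((dropPiece H x.1 x.2).card : ℤ) - H.card) =
      2 * m - 2 * ((roof H).card : ℤ) := by
    rw [Fintype.sum_prod_type]
    have h2 : ∀ k : ZMod m, ∑ s : ℤˣ, (((dropPiece H k s).card : ℤ) - H.card) =
        2 - 2 * exposure H k := by
      intro k
      rw [hH.sum_sign k (f := fun H' => (H'.card : ℤ) - H.card) (a := 1) (b := -1)]
      · unfold exposure; split_ifs <;> norm_num
      · intro s _; rw [card_push]; push_cast; ring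
      · intro h; rw [← hH.card_pop h]; push_cast; ring
    simp only [h2]
    rw [Finset.sum_sub_distrib, ← Finset.mul_sum, hH.sum_exposure, Finset.sum_const,
      Finset.card_univ, ZMod.card, nsmul_eq_mul]
    ring
  have h3 : ∑ x : Step m, (((dropPiece H x.1 x.2).card : ℝ) - H.card) =
      2 * m - 2 * ((roof H).card : ℝ) := by exact_mod_cast h1
  rw [h3]
  field_simp

/-- The expected growth of the heap in one step. -/
theorem expectedSize_succ_sub (n : ℕ) :
    expectedSize m (n + 1) - expectedSize m n = 1 - 1 / m * expectedRoof m n := by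
  rw [expectedSize_eq, expectedSize_eq, expectedRoof_eq, Function.iterate_succ_apply]
  set f : Finset (Piece m) → ℝ := fun H => (H.card : ℝ)
  set g : Finset (Piece m) → ℝ := fun H => ((roof H).card : ℝ)
  -- The one-step identity holds only on heaps, so it is transported by monotonicity on this
  -- invariant set, in both directions.
  have h : (heapTransition)^[n] (heapTransition f - f) ∅ =
      (heapTransition)^[n] ((fun _ => 1) - (1 / (m : ℝ)) • g) ∅ :=
    le_antisymm
      (iterate_heapTransition_mono (fun H hH => hH.transition_card.le) n)
      (iterate_heapTransition_mono (fun H hH => hH.transition_card.ge) n)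
  rw [iterate_transition_sub, iterate_transition_sub, iterate_transition_const,
    iterate_transition_smul] at h
  simpa using h

theorem expectedSize_eq_groupTransition (n : ℕ) :
    expectedSize m n = (groupTransition)^[n] (fun w : LocallyFreeGroup m => (heapLength w : ℝ)) 1 := by
  rw [expectedSize_eq, ← toHeap_one]
  exact (iterate_transition_comp toHeap (fun w x => toHeap_mul_letter w x.1 x.2)
    (fun H => (H.card : ℝ)) n 1).symm

/-- The expected growth of the heap in one step, by first-step decomposition. -/
theorem expectedSize_succ_sub_eq_ground (n : ℕ) :
    expectedSize m (n + 1) - expectedSize m n =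
      (∑ x : Step m, (1 - 2 * (groupTransition)^[n] (ground x.1 (-x.2)) 1)) / (2 * m) := by
  rw [expectedSize_eq_groupTransition, expectedSize_eq_groupTransition,
    Function.iterate_succ_apply', transition_sub_self]
  congr 1
  refine Finset.sum_congr rfl fun x _ => ?_
  set f : LocallyFreeGroup m → ℝ := fun w => (heapLength w : ℝ)
  -- Left multiplication commutes with the right steps of the walk: starting from a letter is the
  -- same as multiplying by it at the end.
  have h1 : (groupTransition)^[n] (fun w => f (letter x.1 x.2 * w)) 1 =
      (groupTransition)^[n] f (letter x.1 x.2 * 1) :=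
    iterate_transition_comp (fun w => letter x.1 x.2 * w) (fun w y => (mul_assoc _ _ _).symm) f n 1
  have h2 : (fun w => f (letter x.1 x.2 * w)) - f =
      (fun _ => (1 : ℝ)) - (2 : ℝ) • ground x.1 (-x.2) := by
    funext w
    exact heapLength_letter_mul w x.1 x.2
  have h3 := congrArg (fun g => (groupTransition)^[n] g 1) h2
  simp only [iterate_transition_sub, iterate_transition_const, iterate_transition_smul,
    Pi.sub_apply, Pi.smul_apply, smul_eq_mul, h1] at h3
  rw [one_mul, ← h3, mul_one]

-- The two formulas for the expected growth, through the roof and through the ground, are equated;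
-- the ground probabilities converge.
variable (m) in
theorem exists_tendsto_expectedRoof :
    ∃ t, Tendsto (fun n : ℕ => 1 / (m : ℝ) * expectedRoof m n) atTop (𝓝 t) := by
  choose b hb using fun x : Step m => exists_tendsto_ground x.1 (-x.2)
  have h := ((tendsto_finsetSum Finset.univ fun x _ =>
    ((hb x).const_mul 2).const_sub 1).div_const (2 * (m : ℝ))).const_sub 1
  refine ⟨_, h.congr fun n => ?_⟩
  rw [← expectedSize_succ_sub_eq_ground, expectedSize_succ_sub]
  ring

theorem tendsto_expectedSize {t : ℝ}
    (h : Tendsto (fun n : ℕ => 1 / (m : ℝ) * expectedRoof m n) atTop (𝓝 t)) :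
    Tendsto (fun n : ℕ => 1 / (n : ℝ) * expectedSize m n) atTop (𝓝 (1 - t)) := by
  refine (h.const_sub 1).cesaro.congr fun n => ?_
  rw [Finset.sum_congr rfl fun i _ => (expectedSize_succ_sub i).symm, Finset.sum_range_sub,
    expectedSize_eq 0, one_div]
  simp

/-- A bound on the drift of a nonnegative functional of the heap bounds the limiting roof. -/
theorem limit_le_of_drift {t : ℝ}
    (h : Tendsto (fun n : ℕ => 1 / (m : ℝ) * expectedRoof m n) atTop (𝓝 t))
    {F : Finset (Piece m) → ℤ} (hF : ∀ H, 0 ≤ F H) {N c : ℤ} (hN : 0 < N)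
    (hd : ∀ H, IsHeap H → N * ∑ k, exposure H k +
      ∑ x : Step m, (F (dropPiece H x.1 x.2) - F H) ≤ c * m) : t ≤ c / N := by
  have hpos := two_mul_pos_cast (m := m)
  have hpos' : (0 : ℝ) < m := by linarith
  set f : Finset (Piece m) → ℝ := fun H => (F H : ℝ)
  set g : Finset (Piece m) → ℝ := fun H => ((roof H).card : ℝ)
  have hN' : (0 : ℝ) < N := by exact_mod_cast hN
  have hstep : ∀ H, IsHeap H →
      (((N : ℝ) / (2 * m)) • g - (f - heapTransition f)) H ≤ c / 2 := by
    intro H hH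
    have h1 : (N : ℝ) * (roof H).card +
        ∑ x : Step m, (f (dropPiece H x.1 x.2) - f H) ≤ c * m := by
      have := hd H hH
      rw [hH.sum_exposure] at this
      simp only [f]
      exact_mod_cast this
    have h2 := transition_sub_self (act := fun H (x : Step m) => dropPiece H x.1 x.2) f H
    have h3 : (N : ℝ) / (2 * m) * g H +
        (∑ x : Step m, (f (dropPiece H x.1 x.2) - f H)) / (2 * m) ≤ c * m / (2 * m) := by
      rw [div_mul_eq_mul_div, ← add_div]
      gcongr
    have h4 : (c : ℝ) * m / (2 * m) = c / 2 := by field_simp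
    simp only [Pi.sub_apply, Pi.smul_apply, smul_eq_mul]
    linarith
  have hmain := le_of_tendsto_of_potential (N := (N : ℝ) / 2) (c := (c : ℝ) / 2)
    (F := fun n => (heapTransition)^[n] f ∅) (by positivity) h
    (fun n => by
      have := iterate_heapTransition_mono (f := fun _ => 0) (g := f)
        (fun H _ => Int.cast_nonneg (hF H)) n
      rwa [iterate_transition_const] at this)
    (fun n => by
      have h5 := iterate_heapTransition_mono (g := fun _ => (c : ℝ) / 2) hstep n
      rw [iterate_transition_const, iterate_transition_sub, iterate_transition_sub,
        iterate_transition_smul] at h5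
      simp only [Pi.sub_apply, Pi.smul_apply, smul_eq_mul] at h5
      rw [Function.iterate_succ_apply, expectedRoof_eq]
      have h6 : (N : ℝ) / 2 * (1 / m * (heapTransition)^[n] g ∅) =
          N / (2 * m) * (heapTransition)^[n] g ∅ := by field_simp
      linarith)
  rwa [div_div_div_cancel_right₀ two_ne_zero] at hmain

theorem limit_le {t : ℝ}
    (h : Tendsto (fun n : ℕ => 1 / (m : ℝ) * expectedRoof m n) atTop (𝓝 t)) :
    t ≤ 0.32893 := by
  rcases hm.out.eq_or_lt with h4 | h5
  · subst h4
    -- The total 26282 = 4 · 6410 + 2 · 321 is not divisible by 4, so the inequality is doubled: 2 ·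
    -- 26282 = 4 · 13141.
    have := limit_le_of_drift h (N := 40000) (c := 13141)
      (F := fun H => 2 * potential 3205 542 429 45 H)
      (fun H => mul_nonneg zero_le_two
        (potential_nonneg (by norm_num) (by norm_num) (by norm_num) (by norm_num) H))
      (by norm_num) (fun H hH => by
        have := hH.potential_drift_le_of_four
        simp only [← mul_sub, ← Finset.mul_sum]
        push_cast
        linarith)
    norm_num at this ⊢
    linarith
  · have := limit_le_of_drift h (N := 2008) (c := 660) (F := potential 314 62 47 9)
      (potential_nonneg (by norm_num) (by norm_num) (by norm_num) (by norm_num))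
      (by norm_num) (fun H hH => hH.potential_drift_le h5)
    norm_num at this ⊢
    linarith

end Limits

theorem theorem1p1 :
    ∃ t ζ : ℕ → ℝ,
      (∀ (m : ℕ) [NeZero m], 4 ≤ m →
        -- the heap process is the random walk on the locally free group
        (∃ Φ : LocallyFreeGroup m → Finset (Piece m),
          Set.BijOn Φ Set.univ {H | IsHeap H} ∧
          ∀ (ξ : ℕ → Step m) (n : ℕ), Φ (groupWalk ξ n) = heapProcess ξ n) ∧
        -- the normalized expected roof size converges, to at most 0.32893
        Tendsto (fun n : ℕ => (1 / (m : ℝ)) * expectedRoof m n) atTop (𝓝 (t m)) ∧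
        t m ≤ 0.32893 ∧
        -- the drift exists and is at least 0.67107
        Tendsto (fun n : ℕ => (1 / (n : ℝ)) * expectedSize m n) atTop (𝓝 (ζ m)) ∧
        ζ m = 1 - t m ∧
        0.67107 ≤ ζ m) ∧
      -- the limits do not tend to 1/3 as the number of generators grows
      ¬ Tendsto t atTop (𝓝 (1 / 3)) := by
  have hex : ∀ m : ℕ, ∃ t : ℝ, ∀ [NeZero m], 4 ≤ m →
      Tendsto (fun n : ℕ => 1 / (m : ℝ) * expectedRoof m n) atTop (𝓝 t) := by
    intro m
    by_cases h : 4 ≤ m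
    · have : NeZero m := ⟨by omega⟩
      have : Fact (4 ≤ m) := ⟨h⟩
      obtain ⟨t, ht⟩ := exists_tendsto_expectedRoof m
      exact ⟨t, fun _ => ht⟩
    -- For m < 4 the value is an arbitrary default without influence on the limit in m.
    · exact ⟨0, fun h' => absurd h' h⟩
  choose t ht using hex
  have hle : ∀ m : ℕ, 4 ≤ m → t m ≤ 0.32893 := by
    intro m h
    have : NeZero m := ⟨by omega⟩
    have : Fact (4 ≤ m) := ⟨h⟩
    exact limit_le (ht m h)
  refine ⟨t, fun m => 1 - t m, fun m _ h => ?_, fun hlim => ?_⟩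
  · have : Fact (4 ≤ m) := ⟨h⟩
    refine ⟨⟨toHeap, bijOn_toHeap, toHeap_groupWalk⟩, ht m h, hle m h,
      tendsto_expectedSize (ht m h), rfl, ?_⟩
    have := hle m h
    norm_num at this ⊢
    linarith
  · have := le_of_tendsto hlim (eventually_atTop.2 ⟨4, hle⟩)
    norm_num at this
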